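/- Let $\Lambda=(0,\infty)$, $\beta>0$, $\gamma>0$, $\eta\in\mathbb R$, $N\ge 0$ an integer, and $A_\gamma(u,v)=\int_\Lambda u'v'\,dx+\gamma\int_\Lambda uv\,dx$ for $u,v\in H^1(\Lambda)$. Let $f$ be a bounded linear functional on $H_0^1(\Lambda)=\{v\in H^1(\Lambda):v(0)=0\}$, and write $(f,v)$ for its value at $v$. For $\alpha\in\mathbb R$ and $k\ge0$ put $$\mathcal L_k^\alpha(x)=\sum_{\nu=0}^k\frac{(\alpha+\nu+1)_{k-\nu}}{(k-\nu)!\,\nu!}(-x)^\nu,\qquad l_k^{\alpha,\beta}(x)=e^{-\beta x/2}\mathcal L_k^\alpha(\beta x),$$ where $(a)_n=a(a+1)\cdots(a+n-1)$. For $n\ge0$ let $X_n^{\beta}=\{e^{-\beta x/2}p(x):p \text{ a real polynomial},\ \deg p\le n\}$ and $X_n^{0,\beta}=\{v\in X_n^\beta: v(0)=0\}$. Define $\varrho_1=\frac{4\gamma+\beta^2}{2\beta}$, $\mathcal S_1^\beta=l_1^{-1,\beta}$ and, for $k\ge2$, $$d_{k-1}=\frac{\beta}{4\varrho_{k-1}}-\frac{\gamma}{\beta\varrho_{k-1}},\qquad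 \varrho_k=-d_{k-1}^2\varrho_{k-1}+\frac\beta2+\frac{2\gamma}\beta,\qquad \mathcal S_k^\beta=l_k^{-1,\beta}-d_{k-1}\mathcal S_{k-1}^\beta .$$ Define further (with $0^0=1$) $$\mathcal S_0^\beta=\sum_{m=0}^\infty\frac{(2\sqrt\gamma-\beta)^m}{(2\sqrt\gamma+\beta)^m}\,l_m^{-1,\beta},$$ $$\mathcal S_{0,N}^\beta=\sum_{m=0}^N\frac{(2\sqrt\gamma+\beta)^{2N+2-m}(2\sqrt\gamma-\beta)^m-(2\sqrt\gamma-\beta)^{2N+2-m}(2\sqrt\gamma+\beta)^m}{(2\sqrt\gamma+\beta)^{2N+2}-(2\sqrt\gamma-\beta)^{2N+2}}\,l_m^{-1,\beta}.$$ Then: 1. $\varrho_k>0$ for all $k\ge1$, and the functions $\mathcal S_k^\beta$ with the constants $\varrho_k$, $k\ge1$, are the unique ones satisfying $\mathcal S_k^\beta\in X_k^{0,\beta}$, $\mathcal S_k^\beta-l_k^{-1,\beta}\in X_{k-1}^{0,\beta}$ and $A_\gamma(\mathcal S_k^\beta,\mathcal S_m^\beta)=\varrho_k\delta_{k,m}$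 for all $k,m\ge1$. 2. The series defining $\mathcal S_0^\beta$ converges in $H^1(\Lambda)$ and at every $x\ge0$, to the same function, $\mathcal S_0^\beta(0)=1$, and $A_\gamma(\mathcal S_0^\beta,v)=0$ for all $v\in H_0^1(\Lambda)$. Moreover $\mathcal S_{0,N}^\beta\in X_N^\beta$, $\mathcal S_{0,N}^\beta(0)=1$, and $A_\gamma(\mathcal S_{0,N}^\beta,v)=0$ for all $v\in X_N^{0,\beta}$. 3. Let $u\in H^1(\Lambda)$ be the weak solution of the Dirichlet problem $-u''+\gamma u=f$ in $\Lambda$, $u(0)=\eta$, $\lim_{x\to\infty}u(x)=0$, i.e. $u(0)=\eta$ and $A_\gamma(u,v)=(f,v)$ for all $v\in H_0^1(\Lambda)$. Then $$u=\eta\,\mathcal S_0^\beta+\sum_{k=1}^\infty\hat u_k\,\mathcal S_k^\beta,\qquad \hat u_k=\frac{1}{\varrho_k}A_\gamma(u,\mathcal S_k^\beta)=\frac{(f,\mathcal S_k^\beta)}{\varrho_k},\quad k\ge1,$$ where the series converges (unconditionally) in $H^1(\Lambda)$, and also at every point $x\ge0$ for the continuous representative of $u$. 4. Let $u_N\in X_N^\beta$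 be the discrete solution, i.e. $u_N(0)=\eta$ and $A_\gamma(u_N,v)=(f,v)$ for all $v\in X_N^{0,\beta}$. Then, with the same coefficients $\hat u_k=(f,\mathcal S_k^\beta)/\varrho_k$, $$u_N=\eta\,\mathcal S_{0,N}^\beta+\sum_{k=1}^N\hat u_k\,\mathcal S_k^\beta .$$ -/

import Mathlib

open MeasureTheory Set Filter Topology Polynomial
open scoped ContDiff

namespace LaguerreDirichlet

noncomputable section

/-- Lebesgue measure on the half line `Λ = (0, ∞)`. -/
abbrev halfLine : Measure ℝ := volume.restrict (Ioi 0)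

/-- The real Hilbert space `L²(Λ)`. -/
abbrev L2 : Type := Lp ℝ 2 halfLine

/-- `g` is a weak derivative of `u` on `Λ`, tested against `C_c^∞(Λ)`. -/
def IsWeakDeriv (u g : ℝ → ℝ) : Prop :=
  ∀ φ : ℝ → ℝ, ContDiff ℝ ∞ φ → HasCompactSupport φ → tsupport φ ⊆ Ioi 0 →
    ∫ x in Ioi 0, u x * deriv φ x = -∫ x in Ioi 0, g x * φ x

lemma memLp_of_continuous_compact {φ : ℝ → ℝ} (h : Continuous φ) (hc : HasCompactSupport φ) :
    MemLp φ 2 halfLine :=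
  (h.memLp_of_hasCompactSupport (μ := volume) hc).mono_measure Measure.restrict_le_self

lemma integrable_mul_test (u : L2) {φ : ℝ → ℝ} (h : Continuous φ) (hc : HasCompactSupport φ) :
    Integrable (fun x => u x * φ x) halfLine :=
  (Lp.memLp u).integrable_mul (memLp_of_continuous_compact h hc)

/-- The Sobolev space `H¹(Λ)`: the pairs `(u, u')` in `L²(Λ) × L²(Λ)` in which the second entry is
the weak derivative of the first. The norm inherited from `L² × L²` is the usual one,
`‖u‖² = ‖u‖²_{L²} + ‖u'‖²_{L²}`. -/
def H1 : Submodule ℝ (WithLp 2 (L2 × L2)) where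
  carrier := {w | IsWeakDeriv w.fst w.snd}
  zero_mem' := by
    intro φ _ _ _
    have h0 : ((0 : L2) : ℝ → ℝ) =ᵐ[halfLine] 0 := Lp.coeFn_zero _ _ _
    have e : ∀ ψ : ℝ → ℝ, ∫ x in Ioi 0, (0 : L2) x * ψ x = 0 := fun ψ => by
      rw [integral_congr_ae (g := fun _ => (0 : ℝ)), integral_zero]
      filter_upwards [h0] with x hx
      rw [hx, Pi.zero_apply, zero_mul]
    exact (e (deriv φ)).trans (neg_zero.symm.trans (congrArg Neg.neg (e φ).symm))
  add_mem' := by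
    intro a b ha hb φ h1 h2 h3
    have hd : Continuous (deriv φ) := h1.continuous_deriv (by simp)
    have e1 : (fun x => (a + b).fst x * deriv φ x) =ᵐ[halfLine]
        fun x => a.fst x * deriv φ x + b.fst x * deriv φ x := by
      filter_upwards [Lp.coeFn_add a.fst b.fst] with x hx
      rw [WithLp.add_fst, hx, Pi.add_apply, add_mul]
    have e2 : (fun x => (a + b).snd x * φ x) =ᵐ[halfLine]
        fun x => a.snd x * φ x + b.snd x * φ x := by
      filter_upwards [Lp.coeFn_add a.snd b.snd] with x hx
      rw [WithLp.add_snd, hx, Pi.add_apply, add_mul]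
    rw [integral_congr_ae e1, integral_congr_ae e2,
      integral_add (integrable_mul_test _ hd h2.deriv) (integrable_mul_test _ hd h2.deriv),
      integral_add (integrable_mul_test _ h1.continuous h2)
        (integrable_mul_test _ h1.continuous h2), ha φ h1 h2 h3, hb φ h1 h2 h3]
    ring
  smul_mem' := by
    intro c a ha φ h1 h2 h3
    have e1 : (fun x => (c • a).fst x * deriv φ x) =ᵐ[halfLine]
        fun x => c * (a.fst x * deriv φ x) := by
      filter_upwards [Lp.coeFn_smul c a.fst] with x hx
      rw [WithLp.smul_fst, hx, Pi.smul_apply, smul_eq_mul, mul_assoc]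
    have e2 : (fun x => (c • a).snd x * φ x) =ᵐ[halfLine] fun x => c * (a.snd x * φ x) := by
      filter_upwards [Lp.coeFn_smul c a.snd] with x hx
      rw [WithLp.smul_snd, hx, Pi.smul_apply, smul_eq_mul, mul_assoc]
    rw [integral_congr_ae e1, integral_congr_ae e2, integral_const_mul, integral_const_mul,
      ha φ h1 h2 h3]
    ring

/-- The underlying `L²` function of an element of `H¹(Λ)`. -/
def val (u : H1) : L2 := u.1.fst

/-- The weak derivative of an element of `H¹(Λ)`. -/
def wderiv (u : H1) : L2 := u.1.snd

/-- The function `U`, restricted to `[0, ∞)`, is the continuous representative of `u`. -/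
def IsContRep (u : H1) (U : ℝ → ℝ) : Prop :=
  ContinuousOn U (Ici 0) ∧ val u =ᵐ[halfLine] U

/-- `u(0) = c`, the boundary value being read off from the continuous representative. -/
def HasTrace (u : H1) (c : ℝ) : Prop :=
  ∃ U : ℝ → ℝ, IsContRep u U ∧ U 0 = c

/-- `H¹₀(Λ) = {v ∈ H¹(Λ) : v(0) = 0}`, with the norm of `H¹(Λ)`. -/
def H01 : Submodule ℝ H1 where
  carrier := {v | HasTrace v 0}
  zero_mem' := ⟨0, ⟨continuousOn_const, Lp.coeFn_zero _ _ _⟩, rfl⟩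
  add_mem' := by
    rintro a b ⟨U, ⟨hU, hU'⟩, hU0⟩ ⟨V, ⟨hV, hV'⟩, hV0⟩
    refine ⟨U + V, ⟨hU.add hV, ?_⟩, by simp [hU0, hV0]⟩
    exact (Lp.coeFn_add (val a) (val b)).trans (hU'.add hV')
  smul_mem' := by
    rintro c a ⟨U, ⟨hU, hU'⟩, hU0⟩
    refine ⟨c • U, ⟨hU.const_smul c, ?_⟩, by simp [hU0]⟩
    exact (Lp.coeFn_smul c (val a)).trans (hU'.const_smul c)

/-- The bilinear form `A_γ(u, v) = (u', v') + γ (u, v)`. -/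
def dirichletForm (γ : ℝ) (u v : H1) : ℝ :=
  inner ℝ (wderiv u) (wderiv v) + γ * inner ℝ (val u) (val v)

/-- The function `x ↦ e^{-βx/2} p(x)`. -/
def expPolyFun (β : ℝ) (p : ℝ[X]) (x : ℝ) : ℝ := Real.exp (-(β / 2) * x) * p.eval x

lemma continuous_expPolyFun (β : ℝ) (p : ℝ[X]) : Continuous (expPolyFun β p) := by
  unfold expPolyFun
  fun_prop

lemma memLp_expPolyFun {β : ℝ} (hβ : 0 < β) (p : ℝ[X]) :
    MemLp (expPolyFun β p) 2 halfLine := by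
  rw [memLp_two_iff_integrable_sq (continuous_expPolyFun β p).aestronglyMeasurable]
  have key : ∀ q : ℝ[X], Integrable (fun x => q.eval x * Real.exp (-β * x)) halfLine := by
    intro q
    induction q using Polynomial.induction_on' with
    | add p q hp hq =>
      refine (hp.add hq).congr (Eventually.of_forall fun x => ?_)
      simp [add_mul]
    | monomial n a =>
      have h := integrableOn_rpow_mul_exp_neg_mul_rpow (p := 1) (s := n) (b := β)
        (by have := n.cast_nonneg (α := ℝ); linarith) one_pos hβ
      simpa [mul_assoc] using h.const_mul a
  refine (key (p ^ 2)).congr (Eventually.of_forall fun x => ?_)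
  simp only [expPolyFun, eval_pow, mul_pow, ← Real.exp_nat_mul]
  rw [mul_comm]
  congr 2
  push_cast
  ring

lemma hasDerivAt_expPolyFun (β : ℝ) (p : ℝ[X]) (x : ℝ) :
    HasDerivAt (expPolyFun β p) (expPolyFun β (derivative p - C (β / 2) * p) x) x := by
  have h1 : HasDerivAt (fun y : ℝ => Real.exp (-(β / 2) * y))
      (Real.exp (-(β / 2) * x) * (-(β / 2) * 1)) x :=
    ((hasDerivAt_id x).const_mul (-(β / 2))).exp
  refine (h1.mul (p.hasDerivAt x)).congr_deriv ?_
  simp only [expPolyFun, eval_sub, eval_mul, eval_C]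
  ring

lemma isWeakDeriv_expPolyFun (β : ℝ) (p : ℝ[X]) :
    IsWeakDeriv (expPolyFun β p) (expPolyFun β (derivative p - C (β / 2) * p)) := by
  intro φ h1 h2 h3
  have hd : Continuous (deriv φ) := h1.continuous_deriv (by simp)
  have c1 := continuous_expPolyFun β p
  have c2 := continuous_expPolyFun β (derivative p - C (β / 2) * p)
  have z : ∀ x, x ∉ Ioi (0 : ℝ) → φ x = 0 := fun x hx =>
    image_eq_zero_of_notMem_tsupport fun h => hx (h3 h)
  have z' : ∀ x, x ∉ Ioi (0 : ℝ) → deriv φ x = 0 := fun x hx =>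
    image_eq_zero_of_notMem_tsupport fun h => hx (h3 (tsupport_deriv_subset (𝕜 := ℝ) h))
  rw [setIntegral_eq_integral_of_forall_compl_eq_zero fun x hx => by rw [z' x hx, mul_zero],
    setIntegral_eq_integral_of_forall_compl_eq_zero fun x hx => by rw [z x hx, mul_zero]]
  exact integral_mul_deriv_eq_deriv_mul_of_integrable
    (fun x _ => hasDerivAt_expPolyFun β p x)
    (fun x _ => ((h1.differentiable (by simp)) x).hasDerivAt)
    ((c1.mul hd).integrable_of_hasCompactSupport h2.deriv.mul_left)
    ((c2.mul h1.continuous).integrable_of_hasCompactSupport h2.mul_left)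
    ((c1.mul h1.continuous).integrable_of_hasCompactSupport h2.mul_left)

/-- The function `x ↦ e^{-βx/2} p(x)`, `β > 0`, as an element of `H¹(Λ)`; the polynomial factor
of its derivative is `p' - (β/2) p`. -/
def expPoly {β : ℝ} (hβ : 0 < β) (p : ℝ[X]) : H1 :=
  ⟨WithLp.toLp 2 ((memLp_expPolyFun hβ p).toLp _,
      (memLp_expPolyFun hβ (derivative p - C (β / 2) * p)).toLp _), by
    intro φ h1 h2 h3
    have e1 := (memLp_expPolyFun hβ p).coeFn_toLp
    have e2 := (memLp_expPolyFun hβ (derivative p - C (β / 2) * p)).coeFn_toLp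
    have h := isWeakDeriv_expPolyFun β p φ h1 h2 h3
    refine (integral_congr_ae (e1.mul (ae_eq_refl (deriv φ)))).trans (h.trans ?_)
    exact congrArg _ (integral_congr_ae (e2.mul (ae_eq_refl φ))).symm⟩

lemma isContRep_expPoly {β : ℝ} (hβ : 0 < β) (p : ℝ[X]) :
    IsContRep (expPoly hβ p) (expPolyFun β p) :=
  ⟨(continuous_expPolyFun β p).continuousOn, (memLp_expPolyFun hβ p).coeFn_toLp⟩

/-- `X_N^β = {e^{-βx/2} p(x) : p ∈ P_N}`. -/
def XN {β : ℝ} (hβ : 0 < β) (N : ℕ) : Set H1 :=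
  {u | ∃ p : ℝ[X], p.natDegree ≤ N ∧ u = expPoly hβ p}

/-- `X_N^{0,β} = {e^{-βx/2} p(x) : p ∈ P_N, p(0) = 0}`. -/
def XN0 {β : ℝ} (hβ : 0 < β) (N : ℕ) : Set H1 :=
  {u | ∃ p : ℝ[X], p.natDegree ≤ N ∧ p.eval 0 = 0 ∧ u = expPoly hβ p}

/-- The generalized Laguerre polynomial
`L_k^α(x) = ∑_{ν=0}^k (α+ν+1)_{k-ν} / ((k-ν)! ν!) (-x)^ν`, for any real `α`. -/
def laguerre (α : ℝ) (k : ℕ) : ℝ[X] :=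
  ∑ ν ∈ Finset.range (k + 1),
    Polynomial.C ((ascPochhammer ℝ (k - ν)).eval (α + ν + 1) / ((k - ν).factorial * ν.factorial)) *
      (-Polynomial.X) ^ ν

/-- The polynomial `L_k^α(βx)`. -/
def scaledLaguerre (α β : ℝ) (k : ℕ) : ℝ[X] :=
  (laguerre α k).comp (Polynomial.C β * Polynomial.X)

/-- The generalized Laguerre function `l_k^{α,β}(x) = e^{-βx/2} L_k^α(βx)`. -/
def lagFun (α β : ℝ) (k : ℕ) (x : ℝ) : ℝ := Real.exp (-(β / 2) * x) * (laguerre α k).eval (β * x)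

/-- The generalized Laguerre function `l_k^{α,β}` as an element of `H¹(Λ)`. -/
def lag (α : ℝ) {β : ℝ} (hβ : 0 < β) (k : ℕ) : H1 := expPoly hβ (scaledLaguerre α β k)

lemma isContRep_lag (α : ℝ) {β : ℝ} (hβ : 0 < β) (k : ℕ) :
    IsContRep (lag α hβ k) (lagFun α β k) := by
  convert! isContRep_expPoly hβ (scaledLaguerre α β k) using 1
  funext x
  simp [lagFun, expPolyFun, scaledLaguerre]

/-- `β / (4 r) - γ / (β r)`. -/
def dOf (β γ r : ℝ) : ℝ := β / (4 * r) - γ / (β * r)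

/-- The constants `ϱ_k`, `k ≥ 1` (the value at `0` is not used): `ϱ_1 = (4γ + β²) / (2β)` and
`ϱ_k = -d_{k-1}² ϱ_{k-1} + β/2 + 2γ/β` with `d_{k-1} = β / (4 ϱ_{k-1}) - γ / (β ϱ_{k-1})`. -/
def rho (β γ : ℝ) : ℕ → ℝ
  | 0 => 0
  | 1 => (4 * γ + β ^ 2) / (2 * β)
  | k + 2 => -(dOf β γ (rho β γ (k + 1))) ^ 2 * rho β γ (k + 1) + β / 2 + 2 * γ / β

/-- The polynomial factors `P_k`, `k ≥ 1`, of the functions `S_k^β(x) = e^{-βx/2} P_k(x)`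
(the value at `0` is not used). After multiplication by `e^{-βx/2}` this is the recurrence
`S_1^β = l_1^{-1,β}`, `S_k^β = l_k^{-1,β} - d_{k-1} S_{k-1}^β`. -/
def sobPoly (β γ : ℝ) : ℕ → ℝ[X]
  | 0 => 0
  | 1 => scaledLaguerre (-1) β 1
  | k + 2 => scaledLaguerre (-1) β (k + 2) -
      Polynomial.C (dOf β γ (rho β γ (k + 1))) * sobPoly β γ (k + 1)

lemma scaledLaguerre_eval_zero (β : ℝ) {k : ℕ} (hk : k ≠ 0) :
    (scaledLaguerre (-1) β k).eval 0 = 0 := by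
  rw [scaledLaguerre, eval_comp, laguerre, eval_finsetSum]
  refine Finset.sum_eq_zero fun ν _ => ?_
  rcases eq_or_ne ν 0 with rfl | hν
  · simp [ascPochhammer_ne_zero_eval_zero ℝ hk]
  · simp [hν]

lemma sobPoly_eval_zero (β γ : ℝ) : ∀ k, (sobPoly β γ k).eval 0 = 0
  | 0 => by simp [sobPoly]
  | 1 => by simpa [sobPoly] using scaledLaguerre_eval_zero β one_ne_zero
  | k + 2 => by
    simp [sobPoly, sobPoly_eval_zero β γ (k + 1),
      scaledLaguerre_eval_zero β (Nat.succ_ne_zero (k + 1))]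

/-- The function `S_k^β`, `k ≥ 1`. -/
def sobFun (β γ : ℝ) (k : ℕ) : ℝ → ℝ := expPolyFun β (sobPoly β γ k)

/-- The function `S_k^β`, `k ≥ 1`, as an element of `H¹₀(Λ)`. -/
def sob {β : ℝ} (hβ : 0 < β) (γ : ℝ) (k : ℕ) : H01 :=
  ⟨expPoly hβ (sobPoly β γ k), _, isContRep_expPoly hβ _, by
    simp [expPolyFun, sobPoly_eval_zero]⟩

/-- `(S_k)_{k ≥ 1}` are the Sobolev orthogonal Laguerre functions in `H¹₀(Λ)`, with squared norms
`r_k`: `S_k ∈ X_k^{0,β}`, `S_k - l_k^{-1,β} ∈ X_{k-1}^{0,β}`, `A_γ(S_k, S_m) = r_k δ_{k,m}`. -/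
structure IsSobolevOrthogonal {β : ℝ} (hβ : 0 < β) (γ : ℝ) (S : ℕ → H01) (r : ℕ → ℝ) : Prop where
  mem : ∀ k ≥ 1, (S k : H1) ∈ XN0 hβ k
  leading : ∀ k ≥ 1, (S k : H1) - lag (-1) hβ k ∈ XN0 hβ (k - 1)
  orthogonal : ∀ k ≥ 1, ∀ m ≥ 1, dirichletForm γ (S k) (S m) = if k = m then r k else 0

/-- The coefficient of `l_m^{-1,β}` in `S_0^β`. -/
def coeff0 (β γ : ℝ) (m : ℕ) : ℝ :=
  (2 * √γ - β) ^ m / (2 * √γ + β) ^ m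

/-- `S_0^β = ∑_{m ≥ 0} (2√γ - β)^m / (2√γ + β)^m l_m^{-1,β}`, a series in `H¹(Λ)`. -/
def S0 {β : ℝ} (hβ : 0 < β) (γ : ℝ) : H1 := ∑' m : ℕ, coeff0 β γ m • lag (-1) hβ m

/-- `S_0^β(x)`, the sum of the pointwise series. -/
def S0Fun (β γ x : ℝ) : ℝ := ∑' m : ℕ, coeff0 β γ m * lagFun (-1) β m x

/-- The coefficient of `l_m^{-1,β}` in `S_{0,N}^β`. -/
def coeff0N (β γ : ℝ) (N m : ℕ) : ℝ :=
  ((2 * √γ + β) ^ (2 * N + 2 - m) * (2 * √γ - β) ^ m -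
      (2 * √γ - β) ^ (2 * N + 2 - m) * (2 * √γ + β) ^ m) /
    ((2 * √γ + β) ^ (2 * N + 2) - (2 * √γ - β) ^ (2 * N + 2))

/-- `S_{0,N}^β`, a combination of `l_0^{-1,β}, …, l_N^{-1,β}`. -/
def S0N {β : ℝ} (hβ : 0 < β) (γ : ℝ) (N : ℕ) : H1 :=
  ∑ m ∈ Finset.range (N + 1), coeff0N β γ N m • lag (-1) hβ m

/-- The weak solution of the Dirichlet problem `-u'' + γ u = f` in `Λ`, `u(0) = η`,
`u(x) → 0` as `x → ∞`, with `f` in the dual of `H¹₀(Λ)`: `u ∈ H¹(Λ)`, `u(0) = η` and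
`A_γ(u, v) = (f, v)` for all `v ∈ H¹₀(Λ)`. -/
def IsWeakSolution (γ : ℝ) (f : H01 →L[ℝ] ℝ) (η : ℝ) (u : H1) : Prop :=
  HasTrace u η ∧ ∀ v : H01, dirichletForm γ u v = f v

/-- The solution of the Laguerre spectral scheme: `u_N ∈ X_N^β`, `u_N(0) = η` and
`A_γ(u_N, v) = (f, v)` for all `v ∈ X_N^{0,β}`. -/
def IsDiscreteSolution {β : ℝ} (hβ : 0 < β) (γ : ℝ) (f : H01 →L[ℝ] ℝ) (η : ℝ) (N : ℕ)
    (uN : H1) : Prop :=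
  uN ∈ XN hβ N ∧ HasTrace uN η ∧ ∀ v : H01, (v : H1) ∈ XN0 hβ N → dirichletForm γ uN v = f v

/-- `û_k = (f, S_k^β) / ϱ_k`, `k ≥ 1`. -/
def uHat {β : ℝ} (hβ : 0 < β) (γ : ℝ) (f : H01 →L[ℝ] ℝ) (k : ℕ) : ℝ :=
  f (sob hβ γ k) / rho β γ k

end

end LaguerreDirichlet

open LaguerreDirichlet

/-! Write λ_k for the image of `lagSum β k` in L²(Λ), that is, e^{-βx/2} times the sum of the
L_j^{-1}(βx) with j < k. Integration by parts makes the λ_k with k ≥ 1 orthogonal with squared norm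
1/β. Since l_k = λ_{k+1} - λ_k and l_k' = -(β/2)(λ_{k+1} + λ_k), the Gram matrix of the l_k^{-1,β}
under A_γ is tridiagonal (`dirichletForm_lag`). Away from index 0 its diagonal entries are 2a and
its off-diagonal entries b, where a = β/4 + γ/β and b = β/4 - γ/β.

Tridiagonality explains all the formulas. Gram-Schmidt on l_1, l_2, ... has only one correction term
at each stage, with pivots ϱ_k = 2a - b²/ϱ_{k-1}, bounded below by a (`le_rho`). A combination of
the l_m with coefficients c_m is orthogonal to l_k, k ≥ 1, when b c_{k-1} + 2a c_k + b c_{k+1} = 0.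
If b ≠ 0, the characteristic roots are q = (2√γ - β)/(2√γ + β) and 1/q. The powers of q, with |q| <
1, give S_0; the solution equal to 1 at m = 0 and 0 at m = N+1 gives S_{0,N}.

The analytic core is that the S_k expand every element of H¹₀ (`hasSum_sob`). The map v ↦ (v', √γ v)
turns A_γ into the inner product of L² × L² and sends H¹₀ into a closed subspace, `energySpace`, cut
out by the integration by parts formula with zero boundary term. The normalized images of the S_k
are a Hilbert basis there (`eq_zero_of_inner_energyMap_lag`): for (a, b) in this subspace orthogonal
to them all, the numbers (a + b, λ_k) satisfy w_k = q w_{k+1} and are bounded, hence vanish.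
Completeness of the functions e^{-βx/2} p in L² then gives b = -a, and an induction on degree gives
a = 0. That completeness is a determinate moment problem, solved by Fourier transform.

The rest is linear algebra and continuity: u - η S_0 lies in H¹₀ and has coefficients (f, S_k)/ϱ_k,
bounded point evaluations turn H¹ convergence into pointwise convergence, and u_N is identified by
testing against S_1, ..., S_N. -/

/-! ### Determinacy of the moment problem under exponential decay. -/

section MomentProblem

open scoped FourierTransform

/-- An integrable function on the line whose Fourier transform vanishes is zero. -/
lemma ae_eq_zero_of_fourier_eq_zero {h : ℝ → ℂ} (hh : Integrable h)
    (h0 : ∀ t : ℝ, ∫ x : ℝ, Complex.exp (t * x * Complex.I) * h x = 0) : ∀ᵐ x, h x = 0 := by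
  refine ae_eq_zero_of_integral_contDiff_smul_eq_zero hh.locallyIntegrable fun g hg hc => ?_
  have hg1 : HasCompactSupport (Complex.ofRealCLM ∘ g) := hc.comp_left rfl
  let G : SchwartzMap ℝ ℂ := hg1.toSchwartzMap (Complex.ofRealCLM.contDiff.comp hg)
  -- Writing the test function as the Fourier transform of a Schwartz function K moves the transform
  -- onto h, where it vanishes.
  set K : SchwartzMap ℝ ℂ := 𝓕⁻ G with hK
  have hG : 𝓕 K = G := FourierTransform.fourier_fourierInv_eq G
  have hz : ∀ w, 𝓕 h w = 0 := fun w => by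
    rw [Real.fourier_real_eq_integral_exp_smul, ← h0 (-2 * Real.pi * w)]
    refine integral_congr_ae (Eventually.of_forall fun x => ?_)
    simp only [smul_eq_mul]
    congr 2
    push_cast
    ring
  have key := VectorFourier.integral_fourierIntegral_smul_eq_flip (L := innerₗ ℝ)
      Real.continuous_fourierChar continuous_inner (K.integrable (μ := volume)) hh
  have e1 : ∀ x, VectorFourier.fourierIntegral Real.fourierChar volume (innerₗ ℝ) K x
      = (g x : ℂ) := fun x => by
    have := congrArg (fun F : SchwartzMap ℝ ℂ => F x) hG
    simpa [SchwartzMap.fourier_coe] using! this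
  have e2 : ∀ x, VectorFourier.fourierIntegral Real.fourierChar volume (innerₗ ℝ).flip h x = 0 :=
    fun x => by
      have : (innerₗ ℝ).flip = innerₗ ℝ := by ext; simp
      rw [this]
      exact hz x
  simp only [e1, e2, smul_zero, integral_zero] at key
  simpa using key

/-- Propagation of vanishing moments along the frequency axis. -/
lemma integral_exp_mul_pow_eq_zero_step {μ : Measure ℝ} {h : ℝ → ℂ} {δ : ℝ}
    (hm : AEStronglyMeasurable h μ)
    (hint : ∀ k : ℕ, Integrable (fun x => |x| ^ k * Real.exp (δ * |x|) * ‖h x‖) μ)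
    {t s : ℝ} (hs : |s| ≤ δ)
    (h0 : ∀ k : ℕ, ∫ x, Complex.exp (t * x * Complex.I) * x ^ k * h x ∂μ = 0) (k : ℕ) :
    ∫ x, Complex.exp ((t + s : ℝ) * x * Complex.I) * x ^ k * h x ∂μ = 0 := by
  have hexp : ∀ x : ℝ, HasSum (fun n : ℕ => (|s| * |x|) ^ n / (n.factorial : ℝ))
      (Real.exp (|s| * |x|)) := fun x => by
    rw [Real.exp_eq_exp_ℝ]
    exact NormedSpace.expSeries_div_hasSum_exp (𝔸 := ℝ) _
  have key := hasSum_integral_of_dominated_convergence (μ := μ)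
    (F := fun (n : ℕ) x => Complex.exp (t * x * Complex.I) * x ^ k * h x *
      ((s * x * Complex.I) ^ n / (n.factorial : ℂ)))
    (f := fun x => Complex.exp ((t + s : ℝ) * x * Complex.I) * x ^ k * h x)
    (fun n x => |x| ^ k * ‖h x‖ * ((|s| * |x|) ^ n / (n.factorial : ℝ)))
    (fun n => ?_) (fun n => ?_) ?_ ?_ ?_
  · refine key.unique ?_
    convert! (hasSum_zero : HasSum (fun _ : ℕ => (0 : ℂ)) 0) using 2 with n
    -- The n-th Taylor term in s is a multiple of the moment of order k + n at frequency t. This is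
    -- why the hypothesis concerns all moments at once.
    have := congrArg (fun z => (s * Complex.I) ^ n / (n.factorial : ℂ) * z) (h0 (k + n))
    simp only [mul_zero, ← integral_const_mul] at this
    rw [← this]
    refine integral_congr_ae (Eventually.of_forall fun x => ?_)
    simp only []
    ring
  · refine ((Continuous.aestronglyMeasurable (by fun_prop)).mul hm).mul
      (Continuous.aestronglyMeasurable (by fun_prop))
  · refine Eventually.of_forall fun x => le_of_eq ?_
    have : ‖Complex.exp (t * x * Complex.I)‖ = 1 := by
      exact_mod_cast Complex.norm_exp_ofReal_mul_I (t * x)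
    simp [this, mul_pow]
  · exact Eventually.of_forall fun x => (hexp x).summable.mul_left _
  · refine (hint k).mono' ?_ (Eventually.of_forall fun x => ?_)
    · simp only [((hexp _).mul_left _).tsum_eq]
      exact ((Continuous.aestronglyMeasurable (by fun_prop)).mul hm.norm).mul
        (Continuous.aestronglyMeasurable (by fun_prop))
    · simp only [((hexp x).mul_left _).tsum_eq]
      rw [Real.norm_of_nonneg (by positivity), mul_right_comm]
      gcongr
  · refine Eventually.of_forall fun x => ?_
    have : HasSum (fun n : ℕ => (s * x * Complex.I) ^ n / (n.factorial : ℂ))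
        (Complex.exp (s * x * Complex.I)) := by
      rw [Complex.exp_eq_exp_ℂ]
      exact NormedSpace.expSeries_div_hasSum_exp (𝔸 := ℂ) _
    convert! this.mul_left (Complex.exp (t * x * Complex.I) * x ^ k * h x) using 1
    push_cast
    rw [add_mul, add_mul, Complex.exp_add]
    ring

/-- A function with exponential decay, all of whose moments vanish, is zero. -/
lemma ae_eq_zero_of_moments_eq_zero {h : ℝ → ℂ} {δ : ℝ} (hδ : 0 < δ)
    (hm : AEStronglyMeasurable h)
    (hint : ∀ k : ℕ, Integrable (fun x => |x| ^ k * Real.exp (δ * |x|) * ‖h x‖))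
    (h0 : ∀ k : ℕ, ∫ x : ℝ, x ^ k * h x = 0) : ∀ᵐ x, h x = 0 := by
  refine ae_eq_zero_of_fourier_eq_zero ?_ fun t => ?_
  · refine (hint 0).mono hm (Eventually.of_forall fun x => ?_)
    rw [norm_mul, norm_norm, Real.norm_of_nonneg (by positivity)]
    refine le_mul_of_one_le_left (norm_nonneg _) ?_
    simpa using mul_nonneg hδ.le (abs_nonneg x)
  -- The frequency t is reached from 0 in n + 1 equal steps, each of length at most δ.
  · obtain ⟨n, hn⟩ := exists_nat_ge (|t| / δ)
    have hn0 : (0 : ℝ) < n + 1 := by positivity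
    set s := t / (n + 1) with hs
    have hsδ : |s| ≤ δ := by
      rw [hs, abs_div, abs_of_pos hn0, div_le_iff₀ hn0]
      rw [div_le_iff₀ hδ] at hn
      nlinarith
    have key : ∀ m : ℕ, ∀ k : ℕ,
        ∫ x : ℝ, Complex.exp ((m * s : ℝ) * x * Complex.I) * x ^ k * h x = 0 := by
      intro m
      induction m with
      | zero => simpa using h0
      | succ m ih =>
        intro k
        have := integral_exp_mul_pow_eq_zero_step hm hint hsδ ih k
        simpa only [Nat.cast_succ, add_mul, one_mul] using this
    have := key (n + 1) 0
    have e : ((n + 1 : ℕ) : ℝ) * s = t := by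
      rw [hs]
      push_cast
      field_simp
    rw [e] at this
    simpa using this

end MomentProblem

namespace LaguerreDirichlet

noncomputable section

/-! ### Completeness of the functions e^{-βx/2} p in L²(Λ). -/

/-- `p ↦ e^{-βx/2} p` as a linear map into `L²(Λ)`. -/
def expL2 {β : ℝ} (hβ : 0 < β) : ℝ[X] →ₗ[ℝ] L2 where
  toFun p := (memLp_expPolyFun hβ p).toLp _
  map_add' p q := by
    rw [← MemLp.toLp_add]
    exact MemLp.toLp_congr _ _ (Eventually.of_forall fun x => by simp [expPolyFun, mul_add])
  map_smul' c p := by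
    rw [RingHom.id_apply, ← MemLp.toLp_const_smul]
    exact MemLp.toLp_congr _ _ (Eventually.of_forall fun x => by
      simp [expPolyFun, mul_left_comm])

lemma coeFn_expL2 {β : ℝ} (hβ : 0 < β) (p : ℝ[X]) : expL2 hβ p =ᵐ[halfLine] expPolyFun β p :=
  (memLp_expPolyFun hβ p).coeFn_toLp

lemma inner_expL2 {β : ℝ} (hβ : 0 < β) (w : L2) (p : ℝ[X]) :
    inner ℝ w (expL2 hβ p) = ∫ x in Ioi 0, w x * expPolyFun β p x := by
  rw [L2.inner_def]
  refine integral_congr_ae ?_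
  filter_upwards [coeFn_expL2 hβ p] with x hx
  simp [hx, mul_comm]

/-- The Laguerre functions are complete in `L²(Λ)`. -/
lemma eq_zero_of_inner_expL2_eq_zero {β : ℝ} (hβ : 0 < β) {w : L2}
    (h : ∀ p, inner ℝ w (expL2 hβ p) = 0) : w = 0 := by
  have hw := Lp.memLp w
  -- The decay e^{-βx/2} is shared: one half absorbs the weight e^{δ|x|} with δ = β/4, the other
  -- leaves x^k e^{-βx/4}, which is still in L² and pairs with w.
  have key := ae_eq_zero_of_moments_eq_zero (δ := β / 4) (by positivity)
    (h := (Ioi (0 : ℝ)).indicator fun x => ((w x * Real.exp (-(β / 2) * x) : ℝ) : ℂ)) ?_ ?_ ?_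
  · refine (Lp.eq_zero_iff_ae_eq_zero).2 ((ae_restrict_iff' measurableSet_Ioi).2 ?_)
    filter_upwards [key] with x hx hx0
    simpa [indicator_of_mem hx0, (Real.exp_pos _).ne'] using hx
  · refine (aestronglyMeasurable_indicator_iff measurableSet_Ioi).2 ?_
    exact Complex.continuous_ofReal.comp_aestronglyMeasurable
      (hw.1.mul (Continuous.aestronglyMeasurable (by fun_prop)))
  · intro k
    have h1 : Integrable (fun x => |w x * expPolyFun (β / 2) (X ^ k) x|) halfLine :=
      (hw.integrable_mul (memLp_expPolyFun (half_pos hβ) (X ^ k))).abs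
    refine ((integrable_indicator_iff measurableSet_Ioi).2 h1).congr
      (Eventually.of_forall fun x => ?_)
    by_cases hx : x ∈ Ioi (0 : ℝ)
    · have hx' : (0 : ℝ) < x := hx
      have he : Real.exp (β / 4 * x) * Real.exp (-(β / 2) * x) = Real.exp (-(β / 2 / 2) * x) := by
        rw [← Real.exp_add]
        congr 1
        ring
      simp only [indicator_of_mem hx, expPolyFun, eval_pow, eval_X, Complex.norm_real,
        Real.norm_eq_abs, abs_mul, abs_of_pos hx', Real.abs_exp, abs_pow, ← he]
      ring
    · simp [indicator_of_notMem hx]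
  · intro k
    have h1 := h (X ^ k)
    rw [inner_expL2, ← integral_indicator measurableSet_Ioi] at h1
    have h2 := congrArg (fun r : ℝ => (r : ℂ)) h1
    simp only [Complex.ofReal_zero, ← integral_complex_ofReal] at h2
    rw [← h2]
    refine integral_congr_ae (Eventually.of_forall fun x => ?_)
    by_cases hx : x ∈ Ioi (0 : ℝ)
    · simp only [indicator_of_mem hx, expPolyFun, eval_pow, eval_X]
      push_cast
      ring
    · simp [indicator_of_notMem hx]

/-! ### Integration by parts on (a, ∞) from the weak derivative, by smooth cutoffs. -/

section Cutoff

open Real (smoothTransition)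

lemma contDiff_smoothTransition : ContDiff ℝ ∞ smoothTransition :=
  Real.smoothTransition.contDiff

lemma continuous_deriv_smoothTransition : Continuous (deriv smoothTransition) :=
  contDiff_smoothTransition.continuous_deriv (by simp)

lemma hasDerivAt_smoothTransition (x : ℝ) :
    HasDerivAt smoothTransition (deriv smoothTransition x) x :=
  (contDiff_smoothTransition.differentiable (by simp) x).hasDerivAt

lemma deriv_smoothTransition_of_nonpos {x : ℝ} (hx : x ≤ 0) : deriv smoothTransition x = 0 :=
  IsLocalMin.deriv_eq_zero <| Eventually.of_forall fun y => by
    rw [Real.smoothTransition.zero_of_nonpos hx]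
    exact Real.smoothTransition.nonneg y

lemma deriv_smoothTransition_of_one_le {x : ℝ} (hx : 1 ≤ x) : deriv smoothTransition x = 0 :=
  IsLocalMax.deriv_eq_zero <| Eventually.of_forall fun y => by
    rw [Real.smoothTransition.one_of_one_le hx]
    exact Real.smoothTransition.le_one y

lemma exists_abs_deriv_smoothTransition_le : ∃ M : ℝ, ∀ x, |deriv smoothTransition x| ≤ M := by
  obtain ⟨M, hM⟩ := (isCompact_Icc (a := (0 : ℝ)) (b := 1)).exists_bound_of_continuousOn
    continuous_deriv_smoothTransition.continuousOn
  refine ⟨max M 0, fun x => ?_⟩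
  by_cases hx : x ∈ Icc (0 : ℝ) 1
  · exact (hM x hx).trans (le_max_left _ _)
  · rcases le_total x 0 with h | h
    · simp [deriv_smoothTransition_of_nonpos h]
    · have : 1 ≤ x := by
        by_contra h'
        exact hx ⟨h, (not_le.1 h').le⟩
      simp [deriv_smoothTransition_of_one_le this]

lemma abs_smoothTransition_le_one (x : ℝ) : |smoothTransition x| ≤ 1 := by
  rw [abs_of_nonneg (Real.smoothTransition.nonneg x)]
  exact Real.smoothTransition.le_one x

/-- The derivatives of the steps `x ↦ smoothTransition (n (x - a) - 1)` are an approximate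
identity at `a`. -/
lemma tendsto_integral_mul_deriv_step {F : ℝ → ℝ} (hF : Continuous F) (a : ℝ) :
    Tendsto (fun n : ℕ => ∫ x, F x * (((n : ℝ) + 1) *
      deriv smoothTransition (((n : ℝ) + 1) * (x - a) - 1))) atTop (𝓝 (F a)) := by
  have hc := continuous_deriv_smoothTransition
  -- The substitution x = a + r (y + 1) with r = 1/(n + 1) turns the n-th integral into this
  -- continuous function of r, whose value at r = 0 is F a.
  have hG : Continuous fun r : ℝ => ∫ y in (0 : ℝ)..1,
      F (a + r * (y + 1)) * deriv smoothTransition y := by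
    refine intervalIntegral.continuous_parametric_intervalIntegral_of_continuous' ?_ 0 1
    simp only [Function.uncurry_def]
    fun_prop
  have h0 : ∫ y in (0 : ℝ)..1, F (a + 0 * (y + 1)) * deriv smoothTransition y = F a := by
    simp only [zero_mul, add_zero, intervalIntegral.integral_const_mul]
    rw [intervalIntegral.integral_deriv_eq_sub
      (fun x _ => (hasDerivAt_smoothTransition x).differentiableAt)
      (hc.intervalIntegrable _ _)]
    simp
  have hlim := (hG.tendsto 0).comp tendsto_one_div_add_atTop_nhds_zero_nat
  rw [h0] at hlim
  refine hlim.congr fun n => ?_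
  have hn : (0 : ℝ) < (n : ℝ) + 1 := by positivity
  simp only [Function.comp]
  rw [intervalIntegral.integral_eq_integral_of_support_subset]
  · have e2 := integral_sub_right_eq_self (μ := volume) (fun x : ℝ =>
      F (a + 1 / ((n : ℝ) + 1) * ((((n : ℝ) + 1) * x - 1) + 1)) *
      deriv smoothTransition (((n : ℝ) + 1) * x - 1) * ((n : ℝ) + 1)) a
    have e3 := integral_sub_right_eq_self (μ := volume) (fun y : ℝ =>
      F (a + 1 / ((n : ℝ) + 1) * (y + 1)) * deriv smoothTransition y * ((n : ℝ) + 1)) 1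
    have e4 := Measure.integral_comp_mul_left (fun y =>
      F (a + 1 / ((n : ℝ) + 1) * ((y - 1) + 1)) *
      deriv smoothTransition (y - 1) * ((n : ℝ) + 1)) ((n : ℝ) + 1)
    rw [e4, e3, abs_of_pos (inv_pos.2 hn), smul_eq_mul,
      integral_mul_const (μ := volume) ((n : ℝ) + 1) (fun y : ℝ =>
        F (a + 1 / ((n : ℝ) + 1) * (y + 1)) * deriv smoothTransition y),
      mul_left_comm, inv_mul_cancel₀ hn.ne', mul_one] at e2
    rw [← e2]
    refine integral_congr_ae (Eventually.of_forall fun x => ?_)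
    have : a + 1 / ((n : ℝ) + 1) * ((((n : ℝ) + 1) * (x - a) - 1) + 1) = x := by
      field_simp
      ring
    simp only [this]
    ring
  · intro y hy
    by_contra hy'
    apply hy
    simp only [mem_Ioc, not_and_or, not_lt, not_le] at hy'
    rcases hy' with h | h
    · simp [deriv_smoothTransition_of_nonpos h]
    · simp [deriv_smoothTransition_of_one_le h.le]

/-- Dominated convergence: the steps are bounded by 1 and tend to the indicator of (a, ∞). -/
lemma tendsto_setIntegral_mul_step {G : ℝ → ℝ} (hG : Integrable G halfLine) {a : ℝ} (ha : 0 ≤ a) :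
    Tendsto (fun n : ℕ => ∫ x in Ioi 0, G x * smoothTransition (((n : ℝ) + 1) * (x - a) - 1))
      atTop (𝓝 (∫ x in Ioi a, G x)) := by
  have e : ∫ x in Ioi a, G x = ∫ x in Ioi 0, (Ioi a).indicator G x := by
    rw [integral_indicator measurableSet_Ioi, Measure.restrict_restrict measurableSet_Ioi,
      inter_eq_left.2 (Ioi_subset_Ioi ha)]
  rw [e]
  refine tendsto_integral_of_dominated_convergence (fun x => ‖G x‖) (fun n => ?_) hG.norm
    (fun n => Eventually.of_forall fun x => ?_) (Eventually.of_forall fun x => ?_)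
  · exact hG.1.mul (Continuous.aestronglyMeasurable (by fun_prop))
  · rw [norm_mul]
    exact mul_le_of_le_one_right (norm_nonneg _) (abs_smoothTransition_le_one _)
  · by_cases hx : x ∈ Ioi a
    · rw [indicator_of_mem hx]
      have hx' : 0 < x - a := sub_pos.2 hx
      obtain ⟨m, hm⟩ := exists_nat_ge (2 / (x - a))
      refine tendsto_const_nhds.congr' ?_
      filter_upwards [eventually_ge_atTop m] with n hn
      rw [Real.smoothTransition.one_of_one_le, mul_one]
      rw [div_le_iff₀ hx'] at hm
      have : (m : ℝ) ≤ n := by exact_mod_cast hn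
      nlinarith
    · rw [indicator_of_notMem hx]
      refine tendsto_const_nhds.congr fun n => ?_
      rw [Real.smoothTransition.zero_of_nonpos, mul_zero]
      have : x - a ≤ 0 := by simpa using hx
      have hn : (0 : ℝ) < (n : ℝ) + 1 := by positivity
      nlinarith

/-- Integration by parts on `(a, ∞)` against a smooth function vanishing near infinity. -/
lemma setIntegral_wderiv_mul_of_eventually_zero {v : H1} {V : ℝ → ℝ} (hV : IsContRep v V) {a : ℝ}
    (ha : 0 ≤ a) {φ : ℝ → ℝ} (h1 : ContDiff ℝ ∞ φ) {R : ℝ} (hR : ∀ x ≥ R, φ x = 0)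
    (m1 : MemLp φ 2 halfLine) (m2 : MemLp (deriv φ) 2 halfLine) :
    (∫ x in Ioi a, wderiv v x * φ x) + ∫ x in Ioi a, val v x * deriv φ x = -(V a * φ a) := by
  have hd : Continuous (deriv φ) := h1.continuous_deriv (by simp)
  -- V is continuous only on [0, ∞). This extension to the line makes the approximate identity
  -- applicable even at a = 0.
  have hW : Continuous fun x => V (max x 0) := by
    rw [← continuousOn_univ]
    exact hV.1.comp (by fun_prop) (fun x _ => le_max_right x 0)
  have i1 := (Lp.memLp (wderiv v)).integrable_mul m1
  have i2 := (Lp.memLp (val v)).integrable_mul m2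
  have i3 := (Lp.memLp (val v)).integrable_mul m1
  have l1 := tendsto_setIntegral_mul_step i1 ha
  have l2 := tendsto_setIntegral_mul_step i2 ha
  have l3 := tendsto_integral_mul_deriv_step (hW.mul h1.continuous) a
  rw [Pi.mul_apply, max_eq_left ha] at l3
  refine eq_neg_of_add_eq_zero_left (tendsto_nhds_unique
    ((l1.add l2).add l3) (tendsto_const_nhds.congr fun n => ?_))
  have hn : (0 : ℝ) < (n : ℝ) + 1 := by positivity
  obtain ⟨M, hM⟩ := exists_abs_deriv_smoothTransition_le
  have hs : ContDiff ℝ ∞ fun x => smoothTransition (((n : ℝ) + 1) * (x - a) - 1) :=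
    contDiff_smoothTransition.comp (by fun_prop)
  have hds : ∀ x, HasDerivAt (fun x => smoothTransition (((n : ℝ) + 1) * (x - a) - 1))
      (((n : ℝ) + 1) * deriv smoothTransition (((n : ℝ) + 1) * (x - a) - 1)) x := fun x => by
    have := (hasDerivAt_smoothTransition (((n : ℝ) + 1) * (x - a) - 1)).comp x
      ((((hasDerivAt_id x).sub_const a).const_mul ((n : ℝ) + 1)).sub_const 1)
    simpa [mul_comm] using! this
  -- The step vanishes up to a + 1/(n + 1), so the product has compact support inside (0, ∞), also
  -- for a = 0, and is an admissible test function.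
  have hsupp : Function.support (fun x => φ x * smoothTransition (((n : ℝ) + 1) * (x - a) - 1)) ⊆
      Icc (a + 1 / ((n : ℝ) + 1)) R := by
    intro x hx
    constructor
    · by_contra h
      apply hx
      have h' : x - a < 1 / ((n : ℝ) + 1) := by linarith [not_le.1 h]
      rw [lt_div_iff₀ hn] at h'
      simp only []
      rw [Real.smoothTransition.zero_of_nonpos (by nlinarith), mul_zero]
    · by_contra h
      apply hx
      simp only []
      rw [hR x (not_le.1 h).le, zero_mul]
  have hts := closure_minimal hsupp isClosed_Icc
  have hwd := v.2 (fun x => φ x * smoothTransition (((n : ℝ) + 1) * (x - a) - 1)) (h1.mul hs)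
    (HasCompactSupport.of_support_subset_isCompact isCompact_Icc hsupp)
    (hts.trans fun x hx => lt_of_lt_of_le (by positivity) hx.1)
  have hder : ∀ x, deriv (fun x => φ x * smoothTransition (((n : ℝ) + 1) * (x - a) - 1)) x =
      deriv φ x * smoothTransition (((n : ℝ) + 1) * (x - a) - 1) +
      φ x * (((n : ℝ) + 1) * deriv smoothTransition (((n : ℝ) + 1) * (x - a) - 1)) := fun x =>
    (((h1.differentiable (by simp)) x).hasDerivAt.mul (hds x)).deriv
  have j1 : Integrable (fun x => val v x * deriv φ x *
      smoothTransition (((n : ℝ) + 1) * (x - a) - 1)) halfLine :=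
    i2.mul_bdd (c := 1) (Continuous.aestronglyMeasurable (by fun_prop))
      (Eventually.of_forall fun x => abs_smoothTransition_le_one _)
  have j2 : Integrable (fun x => val v x * φ x *
      (((n : ℝ) + 1) * deriv smoothTransition (((n : ℝ) + 1) * (x - a) - 1))) halfLine := by
    refine i3.mul_bdd (c := ((n : ℝ) + 1) * M) (Continuous.aestronglyMeasurable ?_)
      (Eventually.of_forall fun x => ?_)
    · have := continuous_deriv_smoothTransition
      fun_prop
    · rw [norm_mul, Real.norm_of_nonneg hn.le]
      exact mul_le_mul_of_nonneg_left (hM _) hn.le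
  have e1 : ∫ x in Ioi 0, v.1.fst x *
      deriv (fun x => φ x * smoothTransition (((n : ℝ) + 1) * (x - a) - 1)) x =
      (∫ x in Ioi 0, val v x * deriv φ x * smoothTransition (((n : ℝ) + 1) * (x - a) - 1)) +
      ∫ x in Ioi 0, val v x * φ x *
        (((n : ℝ) + 1) * deriv smoothTransition (((n : ℝ) + 1) * (x - a) - 1)) := by
    rw [← integral_add j1 j2]
    refine integral_congr_ae (Eventually.of_forall fun x => ?_)
    simp only [hder, val]
    ring
  have e2 : ∫ x in Ioi 0, val v x * φ x *
        (((n : ℝ) + 1) * deriv smoothTransition (((n : ℝ) + 1) * (x - a) - 1)) =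
      ∫ x, V (max x 0) * φ x *
        (((n : ℝ) + 1) * deriv smoothTransition (((n : ℝ) + 1) * (x - a) - 1)) := by
    refine Eq.trans ?_ (setIntegral_eq_integral_of_forall_compl_eq_zero
      (s := Ioi (0 : ℝ)) (μ := volume) fun x hx => ?_)
    · refine integral_congr_ae ?_
      filter_upwards [hV.2, ae_restrict_mem measurableSet_Ioi] with x hx hx0
      rw [hx, max_eq_left (le_of_lt hx0)]
    · rw [deriv_smoothTransition_of_nonpos, mul_zero, mul_zero]
      have : x ≤ 0 := by simpa using hx
      nlinarith
  rw [e1, e2] at hwd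
  have e3 : ∫ x in Ioi 0, v.1.snd x *
      (φ x * smoothTransition (((n : ℝ) + 1) * (x - a) - 1)) =
      ∫ x in Ioi 0, wderiv v x * φ x * smoothTransition (((n : ℝ) + 1) * (x - a) - 1) :=
    integral_congr_ae (Eventually.of_forall fun x => (mul_assoc _ _ _).symm)
  rw [e3] at hwd
  simp only [Pi.mul_apply]
  linarith

/-- Integration by parts on `(a, ∞)` against `e^{-βx/2} p`. -/
lemma setIntegral_wderiv_mul_expPolyFun {β : ℝ} (hβ : 0 < β) {v : H1} {V : ℝ → ℝ}
    (hV : IsContRep v V) {a : ℝ} (ha : 0 ≤ a) (p : ℝ[X]) :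
    (∫ x in Ioi a, wderiv v x * expPolyFun β p x) +
      ∫ x in Ioi a, val v x * expPolyFun β (derivative p - C (β / 2) * p) x =
      -(V a * expPolyFun β p a) := by
  obtain ⟨M, hM⟩ := exists_abs_deriv_smoothTransition_le
  set g := expPolyFun β p with hg
  set g' := expPolyFun β (derivative p - C (β / 2) * p) with hg'
  have cg : Continuous g := continuous_expPolyFun β p
  have cg' : Continuous g' := continuous_expPolyFun β _
  have mg : MemLp g 2 halfLine := memLp_expPolyFun hβ p
  have mg' : MemLp g' 2 halfLine := memLp_expPolyFun hβ _
  have hgd : ∀ x, HasDerivAt g (g' x) x := hasDerivAt_expPolyFun β p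
  have sg : ContDiff ℝ ∞ g := by
    rw [hg]
    unfold expPolyFun
    exact (Real.contDiff_exp.comp (by fun_prop)).mul
      (by simpa using p.contDiff_aeval (𝕜 := ℝ) ∞)
  have cd := continuous_deriv_smoothTransition
  have hle : halfLine.restrict (Ioi a) = volume.restrict (Ioi a) := by
    rw [Measure.restrict_restrict measurableSet_Ioi, inter_eq_left.2 (Ioi_subset_Ioi ha)]
  have res : ∀ {G : ℝ → ℝ}, Integrable G halfLine → Integrable G (volume.restrict (Ioi a)) :=
    fun h => hle ▸ h.restrict
  have i1 := res ((Lp.memLp (wderiv v)).integrable_mul mg)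
  have i2 := res ((Lp.memLp (val v)).integrable_mul mg')
  have i3 := res ((Lp.memLp (val v)).integrable_mul mg)
  have ev1 : ∀ x : ℝ, ∀ᶠ n : ℕ in atTop, 1 ≤ (n : ℝ) - x := fun x => by
    obtain ⟨m, hm⟩ := exists_nat_ge (1 + x)
    filter_upwards [eventually_ge_atTop m] with n hn
    have : (m : ℝ) ≤ n := by exact_mod_cast hn
    linarith
  -- The factor `smoothTransition (n - x)` cuts off at infinity; it tends to 1 pointwise, and its
  -- derivative tends to 0 pointwise and boundedly.
  have lim1 : ∀ {G : ℝ → ℝ}, Integrable G (volume.restrict (Ioi a)) →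
      Tendsto (fun n : ℕ => ∫ x in Ioi a, G x * smoothTransition ((n : ℝ) - x)) atTop
        (𝓝 (∫ x in Ioi a, G x)) := by
    intro G hG
    refine tendsto_integral_of_dominated_convergence (fun x => ‖G x‖) (fun n => ?_) hG.norm
      (fun n => Eventually.of_forall fun x => ?_) (Eventually.of_forall fun x => ?_)
    · exact hG.1.mul (Continuous.aestronglyMeasurable (by fun_prop))
    · rw [norm_mul]
      exact mul_le_of_le_one_right (norm_nonneg _) (abs_smoothTransition_le_one _)
    · refine tendsto_const_nhds.congr' ?_
      filter_upwards [ev1 x] with n hn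
      rw [Real.smoothTransition.one_of_one_le hn, mul_one]
  have lim2 : Tendsto (fun n : ℕ => ∫ x in Ioi a, val v x * g x *
      deriv smoothTransition ((n : ℝ) - x)) atTop (𝓝 (∫ x in Ioi a, (0 : ℝ))) := by
    refine tendsto_integral_of_dominated_convergence (fun x => ‖val v x * g x‖ * M) (fun n => ?_)
      (i3.norm.mul_const M)
      (fun n => Eventually.of_forall fun x => ?_) (Eventually.of_forall fun x => ?_)
    · exact i3.1.mul (Continuous.aestronglyMeasurable (by fun_prop))
    · rw [norm_mul]
      exact mul_le_mul_of_nonneg_left (hM _) (norm_nonneg _)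
    · refine tendsto_const_nhds.congr' ?_
      filter_upwards [ev1 x] with n hn
      rw [deriv_smoothTransition_of_one_le hn, mul_zero]
  have lim3 : Tendsto (fun n : ℕ => -(V a * (g a * smoothTransition ((n : ℝ) - a)))) atTop
      (𝓝 (-(V a * g a))) := by
    refine tendsto_const_nhds.congr' ?_
    filter_upwards [ev1 a] with n hn
    rw [Real.smoothTransition.one_of_one_le hn, mul_one]
  have hlim := (lim1 i1).add ((lim1 i2).sub lim2)
  rw [integral_zero, sub_zero] at hlim
  refine tendsto_nhds_unique hlim (lim3.congr fun n => ?_)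
  have hs : ContDiff ℝ ∞ fun x => smoothTransition ((n : ℝ) - x) :=
    contDiff_smoothTransition.comp (by fun_prop)
  have hder : ∀ x, deriv (fun x => g x * smoothTransition ((n : ℝ) - x)) x =
      g' x * smoothTransition ((n : ℝ) - x) - g x * deriv smoothTransition ((n : ℝ) - x) := by
    intro x
    have := (hasDerivAt_smoothTransition ((n : ℝ) - x)).comp x
      ((hasDerivAt_id x).const_sub (n : ℝ))
    refine ((hgd x).mul this).deriv.trans ?_
    simp only [Function.comp]
    ring
  have n1 : MemLp (fun x => g x * smoothTransition ((n : ℝ) - x)) 2 halfLine := by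
    refine mg.mono (Continuous.aestronglyMeasurable (by fun_prop))
      (Eventually.of_forall fun x => ?_)
    rw [norm_mul]
    exact mul_le_of_le_one_right (norm_nonneg _) (abs_smoothTransition_le_one _)
  have n2 : MemLp (fun x => g' x * smoothTransition ((n : ℝ) - x)) 2 halfLine := by
    refine mg'.mono (Continuous.aestronglyMeasurable (by fun_prop))
      (Eventually.of_forall fun x => ?_)
    rw [norm_mul]
    exact mul_le_of_le_one_right (norm_nonneg _) (abs_smoothTransition_le_one _)
  have n3 : MemLp (fun x => g x * deriv smoothTransition ((n : ℝ) - x)) 2 halfLine := by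
    refine (mg.const_mul M).mono (Continuous.aestronglyMeasurable (by fun_prop))
      (Eventually.of_forall fun x => ?_)
    rw [norm_mul, norm_mul, mul_comm]
    exact mul_le_mul_of_nonneg_right ((hM _).trans (le_abs_self M)) (norm_nonneg _)
  have key := setIntegral_wderiv_mul_of_eventually_zero hV ha (sg.mul hs) (R := n)
    (fun x hx => by rw [Real.smoothTransition.zero_of_nonpos (by linarith), mul_zero]) n1
    ((n2.sub n3).ae_eq (Eventually.of_forall fun x => (hder x).symm))
  rw [← key]
  congr 1
  · exact integral_congr_ae (Eventually.of_forall fun x => (mul_assoc _ _ _).symm)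
  · rw [← integral_sub]
    · refine integral_congr_ae (Eventually.of_forall fun x => ?_)
      simp only [hder, Pi.mul_apply]
      ring
    · exact i2.mul_bdd (c := 1) (Continuous.aestronglyMeasurable (by fun_prop))
        (Eventually.of_forall fun x => abs_smoothTransition_le_one _)
    · exact i3.mul_bdd (c := M) (Continuous.aestronglyMeasurable (by fun_prop))
        (Eventually.of_forall fun x => hM _)

end Cutoff

/-! ### Laguerre polynomials with parameter -1 and their partial sums. -/

section LaguerrePolynomials

lemma coeff_laguerre (α : ℝ) (k n : ℕ) : (laguerre α k).coeff n =
    if n ≤ k then (ascPochhammer ℝ (k - n)).eval (α + n + 1) /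
      ((k - n).factorial * n.factorial) * (-1) ^ n else 0 := by
  have h : ∀ (c : ℝ) (ν : ℕ), (C c * (-X : ℝ[X]) ^ ν).coeff n =
      if n = ν then c * (-1) ^ ν else 0 := fun c ν => by
    have : (C c * (-X : ℝ[X]) ^ ν) = C (c * (-1) ^ ν) * X ^ ν := by
      rw [neg_pow, C_mul, C_pow, C_neg, C_1, mul_assoc]
    rw [this, coeff_C_mul_X_pow]
  simp only [laguerre, finsetSum_coeff, h, Finset.sum_ite_eq, Finset.mem_range,
    Nat.lt_succ_iff]

lemma coeff_zero_laguerre_neg_one (k : ℕ) : (laguerre (-1) (k + 1)).coeff 0 = 0 := by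
  rw [coeff_laguerre]
  simp [ascPochhammer_ne_zero_eval_zero ℝ (Nat.succ_ne_zero k)]

lemma coeff_succ_laguerre_neg_one (k n : ℕ) : (laguerre (-1) (k + 1)).coeff (n + 1) =
    k.choose n / (n + 1).factorial * (-1) ^ (n + 1) := by
  rw [coeff_laguerre]
  split_ifs with h
  · have hn : n ≤ k := by omega
    have e : (-1 : ℝ) + ((n + 1 : ℕ) : ℝ) + 1 = ((n + 1 : ℕ) : ℝ) := by ring
    have hk : k + 1 - (n + 1) = k - n := by omega
    have hf := Nat.factorial_mul_ascFactorial n (k - n)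
    rw [Nat.add_sub_cancel' hn] at hf
    have hf' : (n.factorial : ℝ) * ((n + 1).ascFactorial (k - n) : ℝ) = k.factorial := by
      exact_mod_cast hf
    rw [e, hk, ascPochhammer_nat_eq_natCast_ascFactorial, Nat.cast_choose ℝ hn, ← hf']
    field_simp
  · rw [Nat.choose_eq_zero_of_lt (by omega)]
    simp

lemma laguerre_zero (α : ℝ) : laguerre α 0 = 1 := by simp [laguerre]

/-- On coefficients this is Pascal's rule. -/
lemma derivative_laguerre_neg_one_succ (k : ℕ) : derivative (laguerre (-1) (k + 1)) =
    derivative (laguerre (-1) k) - laguerre (-1) k := by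
  ext n
  rw [coeff_sub, coeff_derivative, coeff_derivative, coeff_succ_laguerre_neg_one]
  have hn : ((n + 1).factorial : ℝ) = (n + 1) * n.factorial := by
    rw [Nat.factorial_succ]
    push_cast
    ring
  have hn1 : (n : ℝ) + 1 ≠ 0 := by positivity
  have hf : (n.factorial : ℝ) ≠ 0 := by positivity
  rcases k with _ | k
  · rw [laguerre_zero, coeff_one, coeff_one]
    rcases n with _ | n
    · simp
    · simp
  · rw [coeff_succ_laguerre_neg_one]
    rcases n with _ | n
    · simp [coeff_zero_laguerre_neg_one]
    · rw [coeff_succ_laguerre_neg_one, Nat.choose_succ_succ, hn]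
      push_cast
      field_simp
      ring

lemma natDegree_scaledLaguerre_le (α β : ℝ) (k : ℕ) : (scaledLaguerre α β k).natDegree ≤ k := by
  have h1 : (laguerre α k).natDegree ≤ k := by
    refine natDegree_le_iff_coeff_eq_zero.2 fun n hn => ?_
    rw [coeff_laguerre, if_neg (by omega)]
  refine natDegree_comp_le.trans ?_
  have h2 : (C β * X : ℝ[X]).natDegree ≤ 1 := (natDegree_C_mul_le _ _).trans natDegree_X_le
  exact (Nat.mul_le_mul h1 h2).trans (by simp)

lemma coeff_scaledLaguerre (α β : ℝ) (k n : ℕ) :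
    (scaledLaguerre α β k).coeff n = (laguerre α k).coeff n * β ^ n := by
  rw [scaledLaguerre, comp_C_mul_X_coeff]

lemma coeff_self_scaledLaguerre_ne_zero (α : ℝ) {β : ℝ} (hβ : 0 < β) (k : ℕ) :
    (scaledLaguerre α β k).coeff k ≠ 0 := by
  rw [coeff_scaledLaguerre, coeff_laguerre, if_pos le_rfl]
  have : (k.factorial : ℝ) ≠ 0 := by positivity
  simp [hβ.ne', this]

/-- The partial sums of the scaled Laguerre polynomials with parameter `-1`, which are the scaled
Laguerre polynomials with parameter `0`, shifted by one. -/
def lagSum (β : ℝ) (k : ℕ) : ℝ[X] := ∑ j ∈ Finset.range k, scaledLaguerre (-1) β j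

lemma lagSum_zero (β : ℝ) : lagSum β 0 = 0 := by simp [lagSum]

lemma lagSum_succ (β : ℝ) (k : ℕ) :
    lagSum β (k + 1) = lagSum β k + scaledLaguerre (-1) β k := Finset.sum_range_succ _ _

lemma scaledLaguerre_zero (α β : ℝ) : scaledLaguerre α β 0 = 1 := by
  simp [scaledLaguerre, laguerre_zero]

lemma lagSum_one (β : ℝ) : lagSum β 1 = 1 := by
  rw [lagSum_succ, lagSum_zero, scaledLaguerre_zero, zero_add]

lemma natDegree_lagSum_succ_le (β : ℝ) (k : ℕ) : (lagSum β (k + 1)).natDegree ≤ k := by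
  refine natDegree_sum_le_of_forall_le _ _ fun j hj => ?_
  have := Finset.mem_range.1 hj
  exact (natDegree_scaledLaguerre_le _ _ _).trans (by omega)

/-- The identity L_{j+1}' = L_j' - L_j telescopes down to L_0' = 0. Both l_k^{-1,β} and its
derivative thereby become combinations of two consecutive partial sums. -/
lemma derivative_scaledLaguerre (β : ℝ) (k : ℕ) :
    derivative (scaledLaguerre (-1) β k) = C (-β) * lagSum β k := by
  induction k with
  | zero => simp [scaledLaguerre_zero, lagSum_zero]
  | succ k ih =>
    rw [lagSum_succ, mul_add, ← ih]
    simp only [scaledLaguerre, derivative_comp, derivative_laguerre_neg_one_succ, derivative_mul,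
      derivative_C, derivative_X, sub_comp, C_neg]
    ring

end LaguerrePolynomials

/-! ### The Dirichlet form and the boundary term at 0. -/

section Bilinear

lemma H1_ext {u v : H1} (h1 : val u = val v) (h2 : wderiv u = wderiv v) : u = v :=
  Subtype.ext <| (WithLp.ofLp_injective 2) (Prod.ext h1 h2)

/-- The Dirichlet form as a bilinear map. -/
def dirichletBilin (γ : ℝ) : H1 →ₗ[ℝ] H1 →ₗ[ℝ] ℝ :=
  LinearMap.mk₂ ℝ (dirichletForm γ)
    (fun u v w => by
      simp only [dirichletForm, show val (u + v) = val u + val v from rfl,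
        show wderiv (u + v) = wderiv u + wderiv v from rfl, inner_add_left]
      ring)
    (fun c u w => by
      simp only [dirichletForm, show val (c • u) = c • val u from rfl,
        show wderiv (c • u) = c • wderiv u from rfl, real_inner_smul_left, smul_eq_mul]
      ring)
    (fun u v w => by
      simp only [dirichletForm, show val (v + w) = val v + val w from rfl,
        show wderiv (v + w) = wderiv v + wderiv w from rfl, inner_add_right]
      ring)
    (fun c u w => by
      simp only [dirichletForm, show val (c • w) = c • val w from rfl,
        show wderiv (c • w) = c • wderiv w from rfl, real_inner_smul_right, smul_eq_mul]
      ring)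

lemma dirichletBilin_apply (γ : ℝ) (u v : H1) :
    dirichletBilin γ u v = dirichletForm γ u v := rfl

lemma dirichletForm_comm (γ : ℝ) (u v : H1) : dirichletForm γ u v = dirichletForm γ v u := by
  simp only [dirichletForm, real_inner_comm]

lemma eq_zero_of_dirichletForm_self {γ : ℝ} (hγ : 0 < γ) {u : H1}
    (h : dirichletForm γ u u = 0) : u = 0 := by
  have h1 : 0 ≤ inner ℝ (wderiv u) (wderiv u) := real_inner_self_nonneg
  have h2 : 0 ≤ inner ℝ (val u) (val u) := real_inner_self_nonneg
  have h3 := mul_nonneg hγ.le h2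
  rw [dirichletForm] at h
  refine H1_ext (inner_self_eq_zero.1 (?_ : inner ℝ (val u) (val u) = 0))
    (inner_self_eq_zero.1 (?_ : inner ℝ (wderiv u) (wderiv u) = 0))
  · refine (mul_eq_zero.1 (?_ : γ * _ = 0)).resolve_left hγ.ne'
    linarith
  · linarith

/-- `p ↦ e^{-βx/2} p` as a linear map into `H¹(Λ)`. -/
def expH1 {β : ℝ} (hβ : 0 < β) : ℝ[X] →ₗ[ℝ] H1 where
  toFun := expPoly hβ
  map_add' p q := by
    refine H1_ext ((expL2 hβ).map_add p q) ?_
    refine Eq.trans ?_ ((expL2 hβ).map_add _ _)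
    change expL2 hβ _ = _
    congr 1
    rw [derivative_add]
    ring
  map_smul' c p := by
    refine H1_ext ((expL2 hβ).map_smul c p) ?_
    refine Eq.trans ?_ ((expL2 hβ).map_smul c _)
    change expL2 hβ _ = _
    congr 1
    rw [derivative_smul, smul_sub, mul_smul_comm]

lemma expH1_apply {β : ℝ} (hβ : 0 < β) (p : ℝ[X]) : expH1 hβ p = expPoly hβ p := rfl

lemma val_expPoly {β : ℝ} (hβ : 0 < β) (p : ℝ[X]) : val (expPoly hβ p) = expL2 hβ p := rfl

lemma wderiv_expPoly {β : ℝ} (hβ : 0 < β) (p : ℝ[X]) :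
    wderiv (expPoly hβ p) = expL2 hβ (derivative p - C (β / 2) * p) := rfl

lemma hasTrace_expPoly {β : ℝ} (hβ : 0 < β) (p : ℝ[X]) :
    HasTrace (expPoly hβ p) (p.eval 0) :=
  ⟨_, isContRep_expPoly hβ p, by simp [expPolyFun]⟩

/-- Integration by parts against `e^{-βx/2} p`. -/
lemma inner_wderiv_add_inner_val {β : ℝ} (hβ : 0 < β) {v : H1} {c : ℝ} (hv : HasTrace v c)
    (p : ℝ[X]) : inner ℝ (wderiv v) (expL2 hβ p) +
      inner ℝ (val v) (expL2 hβ (derivative p - C (β / 2) * p)) = -(c * p.eval 0) := by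
  obtain ⟨V, hV, rfl⟩ := hv
  rw [inner_expL2, inner_expL2, setIntegral_wderiv_mul_expPolyFun hβ hV le_rfl]
  simp [expPolyFun]

lemma expL2_C_mul {β : ℝ} (hβ : 0 < β) (c : ℝ) (p : ℝ[X]) :
    expL2 hβ (C c * p) = c • expL2 hβ p := by
  rw [C_mul', map_smul]

lemma inner_expL2_derivative {β : ℝ} (hβ : 0 < β) (p q : ℝ[X]) :
    β * inner ℝ (expL2 hβ p) (expL2 hβ q) = inner ℝ (expL2 hβ (derivative p)) (expL2 hβ q) +
      inner ℝ (expL2 hβ p) (expL2 hβ (derivative q)) + p.eval 0 * q.eval 0 := by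
  have := inner_wderiv_add_inner_val hβ (hasTrace_expPoly hβ p) q
  rw [wderiv_expPoly, val_expPoly, map_sub, map_sub, expL2_C_mul, expL2_C_mul, inner_sub_left,
    inner_sub_right, real_inner_smul_left, real_inner_smul_right] at this
  linarith

end Bilinear

/-! ### Orthogonality of the partial sums and the tridiagonal Gram matrix. -/

section Gram

variable {β : ℝ} (hβ : 0 < β)

/-- Integration by parts with L_k(βx), whose derivative is -β λ_k and whose boundary term vanishes
for k ≠ 0. The derivative falls on q, which makes inductions on degree possible. -/
lemma inner_lagSum_succ_derivative {k : ℕ} (hk : k ≠ 0) (q : ℝ[X]) :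
    β * inner ℝ (expL2 hβ (lagSum β (k + 1))) (expL2 hβ q) =
      inner ℝ (expL2 hβ (lagSum β (k + 1))) (expL2 hβ (derivative q)) -
      inner ℝ (expL2 hβ (lagSum β k)) (expL2 hβ (derivative q)) := by
  have := inner_expL2_derivative hβ (scaledLaguerre (-1) β k) q
  rw [scaledLaguerre_eval_zero β hk, derivative_scaledLaguerre, expL2_C_mul,
    real_inner_smul_left] at this
  rw [lagSum_succ, map_add, inner_add_left, inner_add_left]
  linarith

lemma inner_lagSum_eq_zero_of_natDegree (n : ℕ) : ∀ (q : ℝ[X]), q.natDegree ≤ n → ∀ k, n < k →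
    inner ℝ (expL2 hβ (lagSum β (k + 1))) (expL2 hβ q) = 0 := by
  induction n with
  | zero =>
    intro q hq k hk
    have := inner_lagSum_succ_derivative hβ hk.ne' q
    rw [derivative_of_natDegree_zero (Nat.le_zero.1 hq)] at this
    simpa [hβ.ne'] using this
  | succ n ih =>
    intro q hq k hk
    have := inner_lagSum_succ_derivative hβ (by omega : k ≠ 0) q
    have hd : (derivative q).natDegree ≤ n := (natDegree_derivative_le q).trans (by omega)
    obtain ⟨j, rfl⟩ : ∃ j, k = j + 1 := ⟨k - 1, by omega⟩
    rw [ih _ hd _ (by omega), ih _ hd _ (by omega)] at this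
    simpa [hβ.ne'] using this

lemma inner_lagSum_derivative_self (k : ℕ) :
    inner ℝ (expL2 hβ (lagSum β (k + 1))) (expL2 hβ (derivative (lagSum β (k + 1)))) = 0 := by
  rcases k with _ | k
  · simp [lagSum_one]
  · exact inner_lagSum_eq_zero_of_natDegree hβ k _
      ((natDegree_derivative_le _).trans (by have := natDegree_lagSum_succ_le β (k + 1); omega))
      _ (by omega)

/-- The norm passes unchanged from λ_{k+1} to λ_{k+2}: once orthogonality to lower degrees is used,
the only surviving term is the pairing of λ_{k+1} with L_{k+1}' = -β λ_{k+1}. -/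
lemma inner_lagSum_self (k : ℕ) :
    β * inner ℝ (expL2 hβ (lagSum β (k + 1))) (expL2 hβ (lagSum β (k + 1))) = 1 := by
  induction k with
  | zero =>
    rw [inner_expL2_derivative, zero_add, lagSum_one]
    simp
  | succ k ih =>
    rw [inner_lagSum_succ_derivative hβ (Nat.succ_ne_zero k), inner_lagSum_derivative_self,
      lagSum_succ β (k + 1), derivative_add, map_add, inner_add_right,
      inner_lagSum_derivative_self, derivative_scaledLaguerre, expL2_C_mul, real_inner_smul_right]
    linarith

lemma inner_lagSum (j k : ℕ) : inner ℝ (expL2 hβ (lagSum β j)) (expL2 hβ (lagSum β k)) =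
    if j = k ∧ j ≠ 0 then 1 / β else 0 := by
  have key : ∀ j k, j < k →
      inner ℝ (expL2 hβ (lagSum β k)) (expL2 hβ (lagSum β j)) = 0 := by
    intro j k hjk
    rcases j with _ | j
    · simp [lagSum_zero]
    · obtain ⟨k, rfl⟩ : ∃ i, k = i + 1 := ⟨k - 1, by omega⟩
      exact inner_lagSum_eq_zero_of_natDegree hβ j _ (natDegree_lagSum_succ_le β j) _ (by omega)
  rcases lt_trichotomy j k with h | rfl | h
  · rw [real_inner_comm, key j k h, if_neg (by omega)]
  · rcases j with _ | j
    · simp [lagSum_zero]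
    · rw [if_pos (by simp), eq_div_iff hβ.ne', mul_comm]
      exact inner_lagSum_self hβ j
  · rw [key k j h, if_neg (by omega)]

lemma val_lag (k : ℕ) :
    val (lag (-1) hβ k) = expL2 hβ (lagSum β (k + 1)) - expL2 hβ (lagSum β k) := by
  rw [lag, val_expPoly, lagSum_succ, map_add, add_sub_cancel_left]

lemma wderiv_lag (k : ℕ) : wderiv (lag (-1) hβ k) =
    (-(β / 2)) • (expL2 hβ (lagSum β (k + 1)) + expL2 hβ (lagSum β k)) := by
  rw [lag, wderiv_expPoly, derivative_scaledLaguerre, map_sub, expL2_C_mul, expL2_C_mul,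
    lagSum_succ, map_add]
  module

/-- The Gram matrix of the Laguerre functions `l_k^{-1,β}` is tridiagonal. -/
lemma dirichletForm_lag (γ : ℝ) (j k : ℕ) : dirichletForm γ (lag (-1) hβ j) (lag (-1) hβ k) =
    if j = k then (if j = 0 then β / 4 + γ / β else β / 2 + 2 * γ / β)
    else if j + 1 = k ∨ k + 1 = j then β / 4 - γ / β else 0 := by
  have hβ' := hβ.ne'
  rw [dirichletForm, val_lag, val_lag, wderiv_lag, wderiv_lag]
  simp only [real_inner_smul_left, real_inner_smul_right, inner_add_left, inner_add_right,
    inner_sub_left, inner_sub_right, inner_lagSum]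
  rcases lt_trichotomy j k with h | rfl | h
  · rcases eq_or_ne (j + 1) k with rfl | h'
    · have h1 : j ≠ j + 1 + 1 := by omega
      simp [h1]
      field_simp
      ring
    · have h1 : j ≠ k := by omega
      have h2 : j ≠ k + 1 := by omega
      have h3 : k + 1 ≠ j := by omega
      simp [h1, h2, h3, h']
  · rcases j with _ | j
    · simp
      field_simp
      ring
    · simp
      field_simp
      ring
  · rcases eq_or_ne (k + 1) j with rfl | h'
    · have h1 : k + 1 + 1 ≠ k := by omega
      simp [h1]
      field_simp
      ring
    · have h1 : j ≠ k := by omega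
      have h2 : j + 1 ≠ k := by omega
      have h3 : j ≠ k + 1 := by omega
      simp [h1, h2, h3, h']

end Gram

/-! ### The spaces X_n^{0,β} and the triangular change of basis from l_k to S_k. -/

lemma coe_sob {β : ℝ} (hβ : 0 < β) (γ : ℝ) (k : ℕ) :
    (sob hβ γ k : H1) = expPoly hβ (sobPoly β γ k) := rfl

lemma coe_sob_one {β : ℝ} (hβ : 0 < β) (γ : ℝ) : (sob hβ γ 1 : H1) = lag (-1) hβ 1 := rfl

lemma coe_sob_succ {β : ℝ} (hβ : 0 < β) (γ : ℝ) (k : ℕ) : (sob hβ γ (k + 2) : H1) =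
    lag (-1) hβ (k + 2) - dOf β γ (rho β γ (k + 1)) • (sob hβ γ (k + 1) : H1) := by
  rw [coe_sob, coe_sob, lag, ← expH1_apply, ← expH1_apply, ← expH1_apply, ← map_smul, ← map_sub,
    smul_eq_C_mul, sobPoly]

section Spaces

/-- The k-th polynomial has degree exactly k and, for k ≥ 1, vanishes at 0, so cancelling the
leading coefficient lowers the degree within the class. Taking for M the kernel of a linear
functional gives orthogonality to all of X_n^{0,β}. -/
lemma mem_of_forall_scaledLaguerre_mem {β : ℝ} (hβ : 0 < β) (M : Submodule ℝ ℝ[X]) (n : ℕ)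
    (hM : ∀ k, 1 ≤ k → k ≤ n → scaledLaguerre (-1) β k ∈ M) :
    ∀ p : ℝ[X], p.natDegree ≤ n → p.eval 0 = 0 → p ∈ M := by
  induction n with
  | zero =>
    intro p hp h0
    rw [eq_C_of_natDegree_eq_zero (Nat.le_zero.1 hp)] at h0 ⊢
    rw [eval_C] at h0
    rw [h0, C_0]
    exact M.zero_mem
  | succ n ih =>
    intro p hp h0
    set P := scaledLaguerre (-1) β (n + 1) with hP
    have hne := coeff_self_scaledLaguerre_ne_zero (-1) hβ (n + 1)
    set c := p.coeff (n + 1) / P.coeff (n + 1) with hc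
    have h1 : p - c • P ∈ M := by
      refine ih (fun k h1 h2 => hM k h1 (by omega)) _ ?_ ?_
      · refine natDegree_le_iff_coeff_eq_zero.2 fun m hm => ?_
        rcases eq_or_lt_of_le (Nat.succ_le_of_lt hm) with h | h
        · subst h
          rw [coeff_sub, coeff_smul, smul_eq_mul, hc, div_mul_cancel₀ _ hne, sub_self]
        · rw [coeff_sub, coeff_smul, coeff_eq_zero_of_natDegree_lt (lt_of_le_of_lt hp h),
            coeff_eq_zero_of_natDegree_lt
              (lt_of_le_of_lt (natDegree_scaledLaguerre_le (-1) β (n + 1)) h)]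
          simp
      · rw [eval_sub, eval_smul, h0, hP, scaledLaguerre_eval_zero β (Nat.succ_ne_zero n)]
        simp
    have h2 := M.add_mem h1 (M.smul_mem c (hM (n + 1) (by omega) le_rfl))
    rwa [sub_add_cancel] at h2

variable {β : ℝ} (hβ : 0 < β)

lemma expPoly_mem_XN0 {p : ℝ[X]} {n : ℕ} (h1 : p.natDegree ≤ n) (h2 : p.eval 0 = 0) :
    expPoly hβ p ∈ XN0 hβ n := ⟨p, h1, h2, rfl⟩

lemma XN0_mono {m n : ℕ} (h : m ≤ n) : XN0 hβ m ⊆ XN0 hβ n := by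
  rintro _ ⟨p, h1, h2, rfl⟩
  exact ⟨p, h1.trans h, h2, rfl⟩

lemma sub_mem_XN0 {u v : H1} {n : ℕ} (hu : u ∈ XN0 hβ n) (hv : v ∈ XN0 hβ n) :
    u - v ∈ XN0 hβ n := by
  obtain ⟨p, h1, h2, rfl⟩ := hu
  obtain ⟨q, h3, h4, rfl⟩ := hv
  exact ⟨p - q, (natDegree_sub_le_of_le h1 h3).trans_eq (max_self n), by simp [h2, h4], ((expH1 hβ).map_sub p q).symm⟩

lemma smul_mem_XN0 {u : H1} {n : ℕ} (c : ℝ) (hu : u ∈ XN0 hβ n) : c • u ∈ XN0 hβ n := by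
  obtain ⟨p, h1, h2, rfl⟩ := hu
  exact ⟨c • p, (natDegree_smul_le c p).trans h1, by simp [h2], ((expH1 hβ).map_smul c p).symm⟩

lemma natDegree_sobPoly_le (γ : ℝ) : ∀ k, (sobPoly β γ k).natDegree ≤ k
  | 0 => by simp [sobPoly]
  | 1 => natDegree_scaledLaguerre_le _ _ _
  | k + 2 => by
    have h := natDegree_sub_le_of_le (natDegree_scaledLaguerre_le (-1) β (k + 2))
      ((natDegree_C_mul_le (dOf β γ (rho β γ (k + 1))) _).trans (natDegree_sobPoly_le γ (k + 1)))
    exact h.trans (by omega)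

lemma sob_mem_XN0 (γ : ℝ) (k : ℕ) : (sob hβ γ k : H1) ∈ XN0 hβ k :=
  expPoly_mem_XN0 hβ (natDegree_sobPoly_le γ k) (sobPoly_eval_zero β γ k)

lemma sob_sub_lag_mem_XN0 (γ : ℝ) {k : ℕ} (hk : 1 ≤ k) :
    (sob hβ γ k : H1) - lag (-1) hβ k ∈ XN0 hβ (k - 1) := by
  obtain ⟨k, rfl⟩ : ∃ j, k = j + 1 := ⟨k - 1, by omega⟩
  rcases k with _ | k
  · rw [coe_sob_one, sub_self]
    exact ⟨0, by simp, by simp, ((expH1 hβ).map_zero).symm⟩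
  · rw [coe_sob_succ, sub_sub_cancel_left, ← neg_smul]
    exact smul_mem_XN0 hβ _ (sob_mem_XN0 hβ γ (k + 1))

lemma dirichletForm_eq_zero_of_forall_lag {γ : ℝ} {w : H1} {n : ℕ}
    (h : ∀ k, 1 ≤ k → k ≤ n → dirichletForm γ w (lag (-1) hβ k) = 0) {v : H1}
    (hv : v ∈ XN0 hβ n) : dirichletForm γ w v = 0 := by
  obtain ⟨p, h1, h2, rfl⟩ := hv
  exact mem_of_forall_scaledLaguerre_mem hβ
    (LinearMap.ker ((dirichletBilin γ w).comp (expH1 hβ))) n h p h1 h2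

lemma dirichletForm_eq_zero_of_forall_sob {γ : ℝ} {w : H1} {n : ℕ}
    (h : ∀ k, 1 ≤ k → k ≤ n → dirichletForm γ w (sob hβ γ k) = 0) {v : H1}
    (hv : v ∈ XN0 hβ n) : dirichletForm γ w v = 0 := by
  refine dirichletForm_eq_zero_of_forall_lag hβ (fun k h1 h2 => ?_) hv
  obtain ⟨k, rfl⟩ : ∃ j, k = j + 1 := ⟨k - 1, by omega⟩
  rcases k with _ | k
  · exact h 1 h1 h2
  · have e := congrArg (dirichletBilin γ w) (coe_sob_succ hβ γ k)
    rw [map_sub, map_smul, dirichletBilin_apply, dirichletBilin_apply, dirichletBilin_apply,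
      h _ h1 h2, h (k + 1) (by omega) (by omega), smul_zero, sub_zero] at e
    exact e.symm

end Spaces

/-! ### Positivity of the pivots ϱ_k, orthogonality and uniqueness of the S_k. -/

lemma dOf_eq {β : ℝ} (hβ : 0 < β) (γ r : ℝ) : dOf β γ r = (β / 4 - γ / β) / r := by
  have := hβ.ne'
  rcases eq_or_ne r 0 with rfl | hr
  · simp [dOf]
  · rw [dOf]
    field_simp

/-- With a = β/4 + γ/β and b = β/4 - γ/β one has b² = a² - γ < a². Hence the map r ↦ 2a - b²/r
preserves [a, ∞), and ϱ_1 = 2a lies in it. -/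
lemma le_rho {β γ : ℝ} (hβ : 0 < β) (hγ : 0 < γ) (k : ℕ) : β / 4 + γ / β ≤ rho β γ (k + 1) := by
  have ha : 0 < β / 4 + γ / β := by positivity
  induction k with
  | zero =>
    have : rho β γ (0 + 1) = 2 * (β / 4 + γ / β) := by
      have := hβ.ne'
      rw [zero_add, rho]
      field_simp
      ring
    linarith
  | succ k ih =>
    have hr : 0 < rho β γ (k + 1) := ha.trans_le ih
    have e1 : rho β γ (k + 1 + 1) =
        2 * (β / 4 + γ / β) - (β / 4 - γ / β) ^ 2 / rho β γ (k + 1) := by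
      rw [rho, dOf_eq hβ]
      field_simp
      ring
    have e2 : (β / 4 - γ / β) ^ 2 = (β / 4 + γ / β) ^ 2 - γ := by
      have := hβ.ne'
      field_simp
      ring
    have e3 : (β / 4 - γ / β) ^ 2 / rho β γ (k + 1) ≤ β / 4 + γ / β := by
      rw [div_le_iff₀ hr, e2]
      nlinarith
    linarith

lemma rho_pos {β γ : ℝ} (hβ : 0 < β) (hγ : 0 < γ) {k : ℕ} (hk : 1 ≤ k) : 0 < rho β γ k := by
  obtain ⟨k, rfl⟩ : ∃ j, k = j + 1 := ⟨k - 1, by omega⟩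
  exact lt_of_lt_of_le (by positivity) (le_rho hβ hγ k)

/-- The products with l_m for m above k + 1 are carried along because the recurrence needs them at
the next stage: d_{k+1} is the quotient of the second value by the third, chosen to cancel the
product of S_{k+2} with l_{k+1}. -/
lemma dirichletForm_sob_lag {β γ : ℝ} (hβ : 0 < β) (hγ : 0 < γ) (k : ℕ) :
    (∀ m, k + 2 < m → dirichletForm γ (sob hβ γ (k + 1)) (lag (-1) hβ m) = 0) ∧
    dirichletForm γ (sob hβ γ (k + 1)) (lag (-1) hβ (k + 2)) = β / 4 - γ / β ∧
    dirichletForm γ (sob hβ γ (k + 1)) (lag (-1) hβ (k + 1)) = rho β γ (k + 1) ∧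
    ∀ m, 1 ≤ m → m ≤ k → dirichletForm γ (sob hβ γ (k + 1)) (lag (-1) hβ m) = 0 := by
  induction k with
  | zero =>
    rw [zero_add, coe_sob_one]
    refine ⟨fun m hm => ?_, ?_, ?_, fun m h1 h2 => by omega⟩
    · rw [dirichletForm_lag, if_neg (by omega), if_neg (by omega)]
    · rw [dirichletForm_lag, if_neg (by omega), if_pos (by omega)]
    · have := hβ.ne'
      rw [dirichletForm_lag, if_pos rfl, if_neg one_ne_zero, rho]
      field_simp
      ring
  | succ k ih =>
    obtain ⟨i1, i2, i3, i4⟩ := ih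
    have hr := (rho_pos hβ hγ (by omega : 1 ≤ k + 1)).ne'
    have e : ∀ m, dirichletForm γ (sob hβ γ (k + 1 + 1)) (lag (-1) hβ m) =
        dirichletForm γ (lag (-1) hβ (k + 2)) (lag (-1) hβ m) - dOf β γ (rho β γ (k + 1)) *
          dirichletForm γ (sob hβ γ (k + 1)) (lag (-1) hβ m) := fun m => by
      have := congrArg (fun w => dirichletBilin γ w (lag (-1) hβ m)) (coe_sob_succ hβ γ k)
      simpa only [map_sub, map_smul, LinearMap.sub_apply, LinearMap.smul_apply] using! this
    refine ⟨fun m hm => ?_, ?_, ?_, fun m h1 h2 => ?_⟩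
    · rw [e, i1 m (by omega), dirichletForm_lag, if_neg (by omega), if_neg (by omega)]
      ring
    · rw [e, i1 _ (by omega), dirichletForm_lag, if_neg (by omega), if_pos (by omega)]
      ring
    · rw [e, i2, dirichletForm_lag, if_pos rfl, if_neg (by omega), rho, dOf_eq hβ]
      field_simp
      ring
    · rcases eq_or_lt_of_le h2 with rfl | h
      · rw [e, i3, dirichletForm_lag, if_neg (by omega), if_pos (by omega), dOf_eq hβ,
          div_mul_cancel₀ _ hr, sub_self]
      · rw [e, i4 m h1 (by omega), dirichletForm_lag, if_neg (by omega), if_neg (by omega)]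
        ring

lemma dirichletForm_sob_eq_zero_of_mem_XN0 {β γ : ℝ} (hβ : 0 < β) (hγ : 0 < γ) {k : ℕ} {v : H1}
    (hv : v ∈ XN0 hβ k) : dirichletForm γ (sob hβ γ (k + 1)) v = 0 :=
  dirichletForm_eq_zero_of_forall_lag hβ (dirichletForm_sob_lag hβ hγ k).2.2.2 hv

lemma dirichletForm_sob {β γ : ℝ} (hβ : 0 < β) (hγ : 0 < γ) {k m : ℕ} (hk : 1 ≤ k) (hm : 1 ≤ m) :
    dirichletForm γ (sob hβ γ k) (sob hβ γ m) = if k = m then rho β γ k else 0 := by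
  have key : ∀ i j, 1 ≤ i → i < j → dirichletForm γ (sob hβ γ j) (sob hβ γ i) = 0 := by
    intro i j hi hij
    obtain ⟨j, rfl⟩ : ∃ l, j = l + 1 := ⟨j - 1, by omega⟩
    exact dirichletForm_sob_eq_zero_of_mem_XN0 hβ hγ
      (XN0_mono hβ (by omega) (sob_mem_XN0 hβ γ i))
  rcases lt_trichotomy k m with h | rfl | h
  · rw [if_neg h.ne, dirichletForm_comm, key k m hk h]
  · rw [if_pos rfl]
    obtain ⟨k, rfl⟩ : ∃ l, k = l + 1 := ⟨k - 1, by omega⟩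
    have h1 := dirichletForm_sob_eq_zero_of_mem_XN0 hβ hγ (sob_sub_lag_mem_XN0 hβ γ hk)
    rw [Nat.add_sub_cancel] at h1
    rw [← dirichletBilin_apply, map_sub, dirichletBilin_apply, dirichletBilin_apply] at h1
    rw [sub_eq_zero.1 h1, (dirichletForm_sob_lag hβ hγ k).2.2.1]
  · rw [if_neg h.ne', key m k hm h]

lemma eq_zero_of_forall_sob {β γ : ℝ} (hβ : 0 < β) (hγ : 0 < γ) {n : ℕ} {v : H1}
    (hv : v ∈ XN0 hβ n) (h : ∀ k, 1 ≤ k → k ≤ n → dirichletForm γ v (sob hβ γ k) = 0) : v = 0 :=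
  eq_zero_of_dirichletForm_self hγ (dirichletForm_eq_zero_of_forall_sob hβ h hv)

lemma isSobolevOrthogonal_iff {β γ : ℝ} (hβ : 0 < β) (hγ : 0 < γ) (S : ℕ → H01) (r : ℕ → ℝ) :
    IsSobolevOrthogonal hβ γ S r ↔ ∀ k ≥ 1, S k = sob hβ γ k ∧ r k = rho β γ k := by
  constructor
  · intro h
    have hS : ∀ k, 1 ≤ k → S k = sob hβ γ k := by
      intro k
      induction k using Nat.strong_induction_on with
      | _ k ih =>
        intro hk
        -- The common leading term l_k cancels. The difference then lies in X_{k-1}^{0,β} and is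
        -- orthogonal to S_1, ..., S_{k-1}, where both families agree by induction, so it is
        -- orthogonal to itself.
        have hD : (S k : H1) - sob hβ γ k ∈ XN0 hβ (k - 1) := by
          have := sub_mem_XN0 hβ (h.leading k hk) (sob_sub_lag_mem_XN0 hβ γ hk)
          rwa [sub_sub_sub_cancel_right] at this
        refine Subtype.ext (sub_eq_zero.1 (eq_zero_of_forall_sob hβ hγ hD fun j h1 h2 => ?_))
        rw [← dirichletBilin_apply, map_sub, LinearMap.sub_apply, dirichletBilin_apply,
          dirichletBilin_apply, dirichletForm_sob hβ hγ hk h1, ← ih j (by omega) h1,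
          h.orthogonal k hk j h1, if_neg (by omega), if_neg (by omega), sub_zero]
    refine fun k hk => ⟨hS k hk, ?_⟩
    have h1 := h.orthogonal k hk k hk
    rw [if_pos rfl, hS k hk, dirichletForm_sob hβ hγ hk hk, if_pos rfl] at h1
    exact h1.symm
  · intro h
    refine ⟨fun k hk => ?_, fun k hk => ?_, fun k hk m hm => ?_⟩
    · rw [(h k hk).1]
      exact sob_mem_XN0 hβ γ k
    · rw [(h k hk).1]
      exact sob_sub_lag_mem_XN0 hβ γ hk
    · rw [(h k hk).1, (h m hm).1, (h k hk).2]
      exact dirichletForm_sob hβ hγ hk hm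

/-! ### The three-term recurrence and the discrete homogeneous solution S_{0,N}. -/

section HomogeneousSolution

/-- A combination of the `l_m^{-1,β}` whose coefficients satisfy the three-term recurrence of the
Gram matrix is orthogonal to `l_k^{-1,β}`. -/
lemma dirichletForm_sum_lag_eq_zero {β γ : ℝ} (hβ : 0 < β) {c : ℕ → ℝ} {k M : ℕ}
    (hM : k + 3 ≤ M) (hc : (β / 4 - γ / β) * c k + (β / 2 + 2 * γ / β) * c (k + 1) +
      (β / 4 - γ / β) * c (k + 2) = 0) :
    dirichletForm γ (∑ m ∈ Finset.range M, c m • lag (-1) hβ m) (lag (-1) hβ (k + 1)) = 0 := by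
  rw [← dirichletBilin_apply, map_sum, LinearMap.sum_apply]
  have e : ∀ m ∈ Finset.range M, dirichletBilin γ (c m • lag (-1) hβ m) (lag (-1) hβ (k + 1)) =
      (if m = k then (β / 4 - γ / β) * c m else 0) +
      (if m = k + 1 then (β / 2 + 2 * γ / β) * c m else 0) +
      (if m = k + 2 then (β / 4 - γ / β) * c m else 0) := by
    intro m _
    rw [map_smul, LinearMap.smul_apply, dirichletBilin_apply, dirichletForm_lag, smul_eq_mul]
    by_cases h1 : m = k
    · subst h1
      simp [mul_comm]
    by_cases h2 : m = k + 1
    · subst h2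
      simp [mul_comm]
    by_cases h3 : m = k + 2
    · subst h3
      simp [mul_comm]
    · rw [if_neg h2, if_neg (by omega), if_neg h1, if_neg h2, if_neg h3]
      ring
  rw [Finset.sum_congr rfl e, Finset.sum_add_distrib, Finset.sum_add_distrib,
    Finset.sum_ite_eq', Finset.sum_ite_eq', Finset.sum_ite_eq', if_pos (by simp; omega),
    if_pos (by simp; omega), if_pos (by simp; omega), hc]

/-- With P = 2√γ + β and Q = 2√γ - β, the coefficients are β/4 - γ/β = -PQ/(4β) and β/2 + 2γ/β = (P²
+ Q²)/(4β). In this form the geometric solutions are visible. -/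
lemma recurrence_of_sqrt {β γ : ℝ} (hβ : 0 < β) (hγ : 0 < γ) {x y z : ℝ}
    (h : (2 * √γ - β) * (2 * √γ + β) * (x + z) =
      ((2 * √γ - β) ^ 2 + (2 * √γ + β) ^ 2) * y) :
    (β / 4 - γ / β) * x + (β / 2 + 2 * γ / β) * y + (β / 4 - γ / β) * z = 0 := by
  have hs : √γ ^ 2 = γ := Real.sq_sqrt hγ.le
  have hβ' := hβ.ne'
  field_simp
  linear_combination (-2 : ℝ) * h + (8 * (x + z) - 16 * y) * hs

lemma sqrt_add_pos {β γ : ℝ} (hβ : 0 < β) : 0 < 2 * √γ + β := by positivity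

lemma abs_sqrt_sub_lt {β γ : ℝ} (hβ : 0 < β) (hγ : 0 < γ) : |2 * √γ - β| < 2 * √γ + β := by
  have := Real.sqrt_pos.2 hγ
  rw [abs_lt]
  constructor <;> linarith

lemma coeff0_zero (β γ : ℝ) : coeff0 β γ 0 = 1 := by simp [coeff0]

lemma coeff0_recurrence {β γ : ℝ} (hβ : 0 < β) (hγ : 0 < γ) (k : ℕ) :
    (β / 4 - γ / β) * coeff0 β γ k + (β / 2 + 2 * γ / β) * coeff0 β γ (k + 1) +
      (β / 4 - γ / β) * coeff0 β γ (k + 2) = 0 := by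
  refine recurrence_of_sqrt hβ hγ ?_
  have := (sqrt_add_pos (γ := γ) hβ).ne'
  simp only [coeff0]
  field_simp
  ring

lemma coeff0N_denom_ne_zero {β γ : ℝ} (hβ : 0 < β) (hγ : 0 < γ) (N : ℕ) :
    (2 * √γ + β) ^ (2 * N + 2) - (2 * √γ - β) ^ (2 * N + 2) ≠ 0 := by
  have h := pow_lt_pow_left₀ (abs_sqrt_sub_lt hβ hγ) (abs_nonneg _)
    (by omega : 2 * N + 2 ≠ 0)
  rw [Even.pow_abs ⟨N + 1, by ring⟩] at h
  exact (sub_pos.2 h).ne'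

lemma coeff0N_zero {β γ : ℝ} (hβ : 0 < β) (hγ : 0 < γ) (N : ℕ) : coeff0N β γ N 0 = 1 := by
  rw [coeff0N, pow_zero, pow_zero, mul_one, mul_one, Nat.sub_zero,
    div_self (coeff0N_denom_ne_zero hβ hγ N)]

lemma coeff0N_succ_self (β γ : ℝ) (N : ℕ) : coeff0N β γ N (N + 1) = 0 := by
  rw [coeff0N, show 2 * N + 2 - (N + 1) = N + 1 by omega, mul_comm, sub_self, zero_div]

lemma coeff0N_recurrence {β γ : ℝ} (hβ : 0 < β) (hγ : 0 < γ) {N k : ℕ} (hk : k + 1 ≤ N) :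
    (β / 4 - γ / β) * coeff0N β γ N k + (β / 2 + 2 * γ / β) * coeff0N β γ N (k + 1) +
      (β / 4 - γ / β) * coeff0N β γ N (k + 2) = 0 := by
  refine recurrence_of_sqrt hβ hγ ?_
  -- Since k + 1 ≤ N, no subtraction in the exponents is truncated: they become e + 2, e + 1 and e.
  obtain ⟨e, he⟩ : ∃ e, 2 * N + 2 = e + (k + 2) := ⟨2 * N - k, by omega⟩
  simp only [coeff0N, ← add_div, mul_div_assoc']
  rw [he, show e + (k + 2) - k = e + 2 by omega, show e + (k + 2) - (k + 1) = e + 1 by omega,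
    Nat.add_sub_cancel]
  ring

lemma S0N_eq {β : ℝ} (hβ : 0 < β) (γ : ℝ) (N : ℕ) : S0N hβ γ N =
    expPoly hβ (∑ m ∈ Finset.range (N + 1), coeff0N β γ N m • scaledLaguerre (-1) β m) := by
  rw [← expH1_apply, map_sum]
  simp only [map_smul]
  rfl

lemma S0N_mem_XN {β : ℝ} (hβ : 0 < β) (γ : ℝ) (N : ℕ) : S0N hβ γ N ∈ XN hβ N := by
  refine ⟨_, natDegree_sum_le_of_forall_le _ _ fun m hm => ?_, S0N_eq hβ γ N⟩
  have := Finset.mem_range.1 hm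
  exact (natDegree_smul_le _ _).trans ((natDegree_scaledLaguerre_le _ _ _).trans (by omega))

lemma hasTrace_S0N {β γ : ℝ} (hβ : 0 < β) (hγ : 0 < γ) (N : ℕ) : HasTrace (S0N hβ γ N) 1 := by
  rw [S0N_eq]
  convert! hasTrace_expPoly hβ _ using 1
  rw [eval_finsetSum, Finset.sum_eq_single 0]
  · simp [coeff0N_zero hβ hγ, scaledLaguerre_zero]
  · intro m _ hm
    simp [scaledLaguerre_eval_zero β hm]
  · simp

lemma dirichletForm_S0N {β γ : ℝ} (hβ : 0 < β) (hγ : 0 < γ) (N : ℕ) {v : H1}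
    (hv : v ∈ XN0 hβ N) : dirichletForm γ (S0N hβ γ N) v = 0 := by
  refine dirichletForm_eq_zero_of_forall_lag hβ (fun k h1 h2 => ?_) hv
  obtain ⟨k, rfl⟩ : ∃ l, k = l + 1 := ⟨k - 1, by omega⟩
  -- The coefficient at N + 1 is zero, so appending it changes nothing and the recurrence also
  -- applies to the last test function l_N.
  have := dirichletForm_sum_lag_eq_zero hβ (M := N + 2) (by omega) (coeff0N_recurrence hβ hγ h2)
  rwa [Finset.sum_range_succ, coeff0N_succ_self, zero_smul, add_zero] at this

end HomogeneousSolution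

/-! ### Completeness of H¹(Λ) and bounded point evaluations. -/

section SobolevSpace

/-- `val` as a continuous linear map. -/
def valCLM : H1 →L[ℝ] L2 := (WithLp.fstL 2 ℝ L2 L2).comp H1.subtypeL

/-- `wderiv` as a continuous linear map. -/
def wderivCLM : H1 →L[ℝ] L2 := (WithLp.sndL 2 ℝ L2 L2).comp H1.subtypeL

lemma valCLM_apply (u : H1) : valCLM u = val u := rfl

lemma continuous_dirichletForm_left (γ : ℝ) (v : H1) :
    Continuous fun u => dirichletForm γ u v :=
  (wderivCLM.continuous.inner continuous_const).add
    ((valCLM.continuous.inner continuous_const).const_mul γ)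

lemma continuous_dirichletForm_right (γ : ℝ) (u : H1) :
    Continuous fun v => dirichletForm γ u v := by
  simpa only [dirichletForm_comm γ u] using continuous_dirichletForm_left γ u

lemma inner_toLp {φ : ℝ → ℝ} (hφ : MemLp φ 2 halfLine) (w : L2) :
    inner ℝ w (hφ.toLp φ) = ∫ x in Ioi 0, w x * φ x := by
  rw [L2.inner_def]
  refine integral_congr_ae ?_
  filter_upwards [hφ.coeFn_toLp] with x hx
  simp [hx, mul_comm]

lemma isClosed_H1 : IsClosed (H1 : Set (WithLp 2 (L2 × L2))) := by
  have e : (H1 : Set (WithLp 2 (L2 × L2))) = ⋂ (φ : ℝ → ℝ) (_ : ContDiff ℝ ∞ φ)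
      (_ : HasCompactSupport φ) (_ : tsupport φ ⊆ Ioi 0),
      {w | ∫ x in Ioi 0, w.fst x * deriv φ x = -∫ x in Ioi 0, w.snd x * φ x} := by
    ext w
    simp only [mem_iInter]
    rfl
  rw [e]
  refine isClosed_iInter fun φ => isClosed_iInter fun h1 => isClosed_iInter fun h2 =>
    isClosed_iInter fun _ => ?_
  have m1 := memLp_of_continuous_compact h1.continuous h2
  have m2 := memLp_of_continuous_compact (h1.continuous_deriv (by simp)) h2.deriv
  simp only [← inner_toLp m1, ← inner_toLp m2]
  exact isClosed_eq ((WithLp.fstL 2 ℝ L2 L2).continuous.inner continuous_const)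
    ((WithLp.sndL 2 ℝ L2 L2).continuous.inner continuous_const).neg

instance : CompleteSpace H1 := isClosed_H1.completeSpace_coe

lemma norm_sq_eq_dirichletForm (u : H1) : ‖u‖ ^ 2 = dirichletForm 1 u u := by
  rw [dirichletForm, real_inner_self_eq_norm_sq, real_inner_self_eq_norm_sq, one_mul, add_comm]
  exact WithLp.prod_norm_sq_eq_of_L2 u.1

lemma norm_val_le (u : H1) : ‖val u‖ ≤ ‖u‖ := by
  have h := norm_sq_eq_dirichletForm u
  rw [dirichletForm, real_inner_self_eq_norm_sq, real_inner_self_eq_norm_sq] at h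
  exact abs_le_of_sq_le_sq' (by nlinarith [sq_nonneg ‖wderiv u‖]) (norm_nonneg _) |>.2

lemma norm_wderiv_le (u : H1) : ‖wderiv u‖ ≤ ‖u‖ := by
  have h := norm_sq_eq_dirichletForm u
  rw [dirichletForm, real_inner_self_eq_norm_sq, real_inner_self_eq_norm_sq] at h
  exact abs_le_of_sq_le_sq' (by nlinarith [sq_nonneg ‖val u‖]) (norm_nonneg _) |>.2

/-- Point evaluations are bounded on `H¹(Λ)`. -/
lemma exists_evaluation : ∃ K : ℝ, ∀ x ≥ 0, ∃ T : H1 →L[ℝ] ℝ,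
    (∀ (v : H1) (V : ℝ → ℝ), IsContRep v V → V x = T v) ∧
    ∀ v, |T v| ≤ Real.exp x * (K * ‖v‖) := by
  -- Integrating by parts against e^{-y} on (x, ∞) gives V(x) = e^x ∫_x^∞ (v - v') e^{-y} dy, a
  -- bounded functional of (v, v'). The L² norm of e^{-y} on (x, ∞) is bounded by that on (0, ∞), so
  -- the constant K is uniform in x.
  have m := memLp_expPolyFun (β := 2) two_pos 1
  refine ⟨2 * ‖m.toLp _‖, fun x hx => ?_⟩
  have mi : MemLp ((Ioi x).indicator (expPolyFun 2 1)) 2 halfLine := m.indicator measurableSet_Ioi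
  set g := mi.toLp _ with hg
  have hgn : ‖g‖ ≤ ‖m.toLp _‖ := by
    refine Lp.norm_le_norm_of_ae_le ?_
    filter_upwards [mi.coeFn_toLp, m.coeFn_toLp] with y h1 h2
    rw [h1, h2]
    exact norm_indicator_le_norm_self _ _
  refine ⟨Real.exp x • ((innerSL ℝ g).comp valCLM - (innerSL ℝ g).comp wderivCLM),
    fun v V hV => ?_, fun v => ?_⟩
  · have key := setIntegral_wderiv_mul_expPolyFun two_pos hV hx 1
    have hi : ∀ w : L2, inner ℝ g w = ∫ y in Ioi x, w y * expPolyFun 2 1 y := fun w => by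
      rw [real_inner_comm, inner_toLp]
      have : ∀ y, w y * (Ioi x).indicator (expPolyFun 2 1) y =
          (Ioi x).indicator (fun y => w y * expPolyFun 2 1 y) y := fun y => by
        by_cases hy : y ∈ Ioi x
        · simp [indicator_of_mem hy]
        · simp [indicator_of_notMem hy]
      simp only [this]
      rw [integral_indicator measurableSet_Ioi, Measure.restrict_restrict measurableSet_Ioi,
        inter_eq_left.2 (Ioi_subset_Ioi hx)]
    have hd : ∀ y, expPolyFun 2 (derivative 1 - C (2 / 2) * 1) y = -expPolyFun 2 1 y := fun y => by
      simp [expPolyFun]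
    simp only [hd, mul_neg, integral_neg] at key
    have e : Real.exp x * Real.exp (-x) = 1 := by
      rw [← Real.exp_add, add_neg_cancel, Real.exp_zero]
    have hx1 : expPolyFun 2 1 x = Real.exp (-x) := by simp [expPolyFun]
    rw [hx1] at key
    change V x = Real.exp x * (inner ℝ g (val v) - inner ℝ g (wderiv v))
    rw [hi, hi]
    linear_combination (-V x) * e + Real.exp x * key
  · change |Real.exp x * (inner ℝ g (val v) - inner ℝ g (wderiv v))| ≤ _
    rw [abs_mul, Real.abs_exp]
    refine mul_le_mul_of_nonneg_left ?_ (Real.exp_pos x).le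
    have h1 := (abs_real_inner_le_norm g (val v)).trans
      (mul_le_mul hgn (norm_val_le v) (norm_nonneg _) (norm_nonneg _))
    have h2 := (abs_real_inner_le_norm g (wderiv v)).trans
      (mul_le_mul hgn (norm_wderiv_le v) (norm_nonneg _) (norm_nonneg _))
    have h3 := abs_sub (inner ℝ g (val v)) (inner ℝ g (wderiv v))
    linarith

lemma HasTrace.unique {v : H1} {c d : ℝ} (hc : HasTrace v c) (hd : HasTrace v d) : c = d := by
  obtain ⟨K, hK⟩ := exists_evaluation
  obtain ⟨T, hT, -⟩ := hK 0 le_rfl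
  obtain ⟨U, hU, rfl⟩ := hc
  obtain ⟨V, hV, rfl⟩ := hd
  rw [hT _ _ hU, hT _ _ hV]

lemma IsContRep.sub_smul {u v : H1} {U V : ℝ → ℝ} (hU : IsContRep u U) (hV : IsContRep v V)
    (c : ℝ) : IsContRep (u - c • v) (fun x => U x - c * V x) := by
  refine ⟨hU.1.sub (hV.1.const_smul c), ?_⟩
  refine (Lp.coeFn_sub (val u) (c • val v)).trans ?_
  exact hU.2.sub ((Lp.coeFn_smul c (val v)).trans (hV.2.const_smul c))

end SobolevSpace

/-! ### The homogeneous solution S_0 as a geometrically convergent series. -/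

section HomogeneousSolution

variable {β : ℝ} (hβ : 0 < β)

lemma exists_norm_lag_le : ∃ K : ℝ, ∀ m, ‖lag (-1) hβ m‖ ≤ K := by
  refine ⟨√(β / 2 + 2 * 1 / β), fun m => Real.le_sqrt_of_sq_le ?_⟩
  rw [norm_sq_eq_dirichletForm, dirichletForm_lag, if_pos rfl]
  have : 0 < 1 / β := by positivity
  split_ifs
  · rw [mul_div_assoc]
    linarith
  · exact le_rfl

lemma summable_abs_coeff0 {β γ : ℝ} (hβ : 0 < β) (hγ : 0 < γ) :
    Summable fun m => |coeff0 β γ m| := by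
  have hP := sqrt_add_pos (γ := γ) hβ
  have : ∀ m, |coeff0 β γ m| = (|2 * √γ - β| / (2 * √γ + β)) ^ m := fun m => by
    rw [coeff0, ← div_pow, abs_pow, abs_div, abs_of_pos hP]
  simp only [this]
  exact summable_geometric_of_lt_one (by positivity) ((div_lt_one hP).2 (abs_sqrt_sub_lt hβ hγ))

lemma hasSum_S0 {β γ : ℝ} (hβ : 0 < β) (hγ : 0 < γ) :
    HasSum (fun m : ℕ => coeff0 β γ m • lag (-1) hβ m) (S0 hβ γ) := by
  obtain ⟨K, hK⟩ := exists_norm_lag_le hβ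
  refine (Summable.of_norm_bounded ((summable_abs_coeff0 hβ hγ).mul_right K) fun m => ?_).hasSum
  rw [norm_smul, Real.norm_eq_abs]
  exact mul_le_mul_of_nonneg_left (hK m) (abs_nonneg _)

lemma hasSum_S0Fun {β γ : ℝ} (hβ : 0 < β) (hγ : 0 < γ) {x : ℝ} (hx : 0 ≤ x) :
    HasSum (fun m : ℕ => coeff0 β γ m * lagFun (-1) β m x) (S0Fun β γ x) := by
  obtain ⟨K, hK⟩ := exists_evaluation
  obtain ⟨T, hT, -⟩ := hK x hx
  have h := T.hasSum (hasSum_S0 hβ hγ)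
  simp only [map_smul, ← hT _ _ (isContRep_lag (-1) hβ _), smul_eq_mul] at h
  exact h.summable.hasSum

/-- The evaluation bound grows like e^x; after multiplication by e^{-x} the series converges
uniformly on [0, ∞). -/
lemma continuousOn_S0Fun {β γ : ℝ} (hβ : 0 < β) (hγ : 0 < γ) :
    ContinuousOn (S0Fun β γ) (Ici 0) := by
  obtain ⟨K, hK⟩ := exists_evaluation
  obtain ⟨K', hK'⟩ := exists_norm_lag_le hβ
  have h : ContinuousOn (fun x => ∑' m, Real.exp (-x) * (coeff0 β γ m * lagFun (-1) β m x))
      (Ici 0) := by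
    refine continuousOn_tsum (fun m => ?_)
      ((summable_abs_coeff0 hβ hγ).mul_right (|K| * K')) fun m x hx => ?_
    · have := (isContRep_lag (-1) hβ m).1
      fun_prop
    · obtain ⟨T, hT, hT'⟩ := hK x hx
      rw [hT _ _ (isContRep_lag (-1) hβ m), norm_mul, norm_mul, mul_left_comm, Real.norm_eq_abs,
        Real.norm_eq_abs, Real.norm_eq_abs, Real.abs_exp]
      refine mul_le_mul_of_nonneg_left ?_ (abs_nonneg _)
      refine (mul_le_mul_of_nonneg_left (hT' _) (Real.exp_pos _).le).trans ?_
      rw [← mul_assoc, ← Real.exp_add, neg_add_cancel, Real.exp_zero, one_mul]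
      exact mul_le_mul (le_abs_self K) (hK' m) (norm_nonneg _) (abs_nonneg _)
  refine (Real.continuous_exp.continuousOn.mul h).congr fun x _ => ?_
  simp only [tsum_mul_left, Pi.mul_apply]
  rw [← mul_assoc, ← Real.exp_add, add_neg_cancel, Real.exp_zero, one_mul, S0Fun]

lemma isContRep_sum_lag (c : ℕ → ℝ) (n : ℕ) :
    IsContRep (∑ m ∈ Finset.range n, c m • lag (-1) hβ m)
      (fun x => ∑ m ∈ Finset.range n, c m * lagFun (-1) β m x) := by
  convert! isContRep_expPoly hβ (∑ m ∈ Finset.range n, c m • scaledLaguerre (-1) β m) using 1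
  · rw [← expH1_apply, map_sum]
    simp only [map_smul]
    rfl
  · funext x
    simp only [expPolyFun, eval_finsetSum, eval_smul, Finset.mul_sum, lagFun, scaledLaguerre,
      eval_comp, eval_mul, eval_C, eval_X, smul_eq_mul]
    exact Finset.sum_congr rfl fun m _ => by ring

/-- The partial sums converge in L², hence almost everywhere along a subsequence, and there the
limit must be the pointwise sum. -/
lemma isContRep_S0 {β γ : ℝ} (hβ : 0 < β) (hγ : 0 < γ) :
    IsContRep (S0 hβ γ) (S0Fun β γ) := by
  refine ⟨continuousOn_S0Fun hβ hγ, ?_⟩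
  have h1 := ((valCLM.continuous.tendsto _).comp (hasSum_S0 hβ hγ).tendsto_sum_nat)
  obtain ⟨ns, hns, hae⟩ := (tendstoInMeasure_of_tendsto_Lp h1).exists_seq_tendsto_ae
  have h2 : ∀ᵐ x ∂halfLine, ∀ n : ℕ,
      val (∑ m ∈ Finset.range n, coeff0 β γ m • lag (-1) hβ m) x =
        ∑ m ∈ Finset.range n, coeff0 β γ m * lagFun (-1) β m x :=
    ae_all_iff.2 fun n => (isContRep_sum_lag hβ (coeff0 β γ) n).2
  filter_upwards [hae, h2, ae_restrict_mem measurableSet_Ioi] with x hx1 hx2 hx3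
  refine tendsto_nhds_unique hx1 ?_
  simp only [Function.comp_apply, valCLM_apply, hx2]
  exact (hasSum_S0Fun hβ hγ (le_of_lt hx3)).tendsto_sum_nat.comp hns.tendsto_atTop

lemma hasTrace_S0 {β γ : ℝ} (hβ : 0 < β) (hγ : 0 < γ) : HasTrace (S0 hβ γ) 1 := by
  refine ⟨_, isContRep_S0 hβ hγ, ?_⟩
  have h : ∀ m, lagFun (-1) β m 0 = (scaledLaguerre (-1) β m).eval 0 := fun m => by
    simp [lagFun, scaledLaguerre]
  rw [S0Fun, tsum_eq_single 0]
  · rw [h, coeff0_zero, scaledLaguerre_zero]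
    simp
  · intro m hm
    rw [h, scaledLaguerre_eval_zero β hm, mul_zero]

lemma dirichletForm_S0_lag {β γ : ℝ} (hβ : 0 < β) (hγ : 0 < γ) {k : ℕ} (hk : 1 ≤ k) :
    dirichletForm γ (S0 hβ γ) (lag (-1) hβ k) = 0 := by
  obtain ⟨k, rfl⟩ : ∃ l, k = l + 1 := ⟨k - 1, by omega⟩
  have h := ((continuous_dirichletForm_left γ (lag (-1) hβ (k + 1))).tendsto _).comp
    (hasSum_S0 hβ hγ).tendsto_sum_nat
  refine tendsto_nhds_unique h (tendsto_const_nhds.congr' ?_)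
  filter_upwards [eventually_ge_atTop (k + 3)] with n hn
  exact (dirichletForm_sum_lag_eq_zero hβ hn (coeff0_recurrence hβ hγ k)).symm

lemma dirichletForm_S0_sob {β γ : ℝ} (hβ : 0 < β) (hγ : 0 < γ) (k : ℕ) :
    dirichletForm γ (S0 hβ γ) (sob hβ γ k) = 0 :=
  dirichletForm_eq_zero_of_forall_lag hβ (fun _ h _ => dirichletForm_S0_lag hβ hγ h)
    (sob_mem_XN0 hβ γ k)

end HomogeneousSolution

/-! ### Completeness of the S_k in the energy space. -/

section Completeness

/-- `v ↦ (v', √γ v)`, which turns the Dirichlet form into the inner product of `L² × L²`. -/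
def energyMap (γ : ℝ) : H1 →ₗ[ℝ] WithLp 2 (L2 × L2) where
  toFun v := WithLp.toLp 2 (wderiv v, √γ • val v)
  map_add' u v := by
    rw [show val (u + v) = val u + val v from rfl,
      show wderiv (u + v) = wderiv u + wderiv v from rfl, smul_add]
    rfl
  map_smul' c u := by
    rw [show val (c • u) = c • val u from rfl, show wderiv (c • u) = c • wderiv u from rfl,
      smul_comm]
    rfl

lemma inner_energyMap {γ : ℝ} (hγ : 0 < γ) (u v : H1) :
    inner ℝ (energyMap γ u) (energyMap γ v) = dirichletForm γ u v := by
  rw [WithLp.prod_inner_apply, dirichletForm]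
  change inner ℝ (wderiv u) (wderiv v) + inner ℝ (√γ • val u) (√γ • val v) = _
  rw [real_inner_smul_left, real_inner_smul_right, ← mul_assoc, Real.mul_self_sqrt hγ.le]

/-- `p ↦ (e^{-βx/2} p, (e^{-βx/2} p)' / √γ)`. Orthogonality of `(v', √γ v)` to the range of this map
expresses that `v` vanishes at `0`. -/
def traceMap {β : ℝ} (hβ : 0 < β) (γ : ℝ) : ℝ[X] →ₗ[ℝ] WithLp 2 (L2 × L2) where
  toFun p := WithLp.toLp 2 (expL2 hβ p, (√γ)⁻¹ • wderiv (expH1 hβ p))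
  map_add' p q := by
    rw [map_add, map_add, show wderiv (expH1 hβ p + expH1 hβ q) =
      wderiv (expH1 hβ p) + wderiv (expH1 hβ q) from rfl, smul_add]
    rfl
  map_smul' c p := by
    rw [map_smul, map_smul, show wderiv (c • expH1 hβ p) = c • wderiv (expH1 hβ p) from rfl,
      smul_comm]
    rfl

lemma inner_traceMap_energyMap {β γ : ℝ} (hβ : 0 < β) (hγ : 0 < γ) {v : H1} (hv : HasTrace v 0)
    (p : ℝ[X]) : inner ℝ (traceMap hβ γ p) (energyMap γ v) = 0 := by
  have h := inner_wderiv_add_inner_val hβ hv p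
  have hs := (Real.sqrt_pos.2 hγ).ne'
  rw [WithLp.prod_inner_apply]
  change inner ℝ (expL2 hβ p) (wderiv v) +
    inner ℝ ((√γ)⁻¹ • wderiv (expPoly hβ p)) (√γ • val v) = 0
  rw [real_inner_smul_left, real_inner_smul_right, inv_mul_cancel_left₀ hs, wderiv_expPoly,
    real_inner_comm, real_inner_comm (val v), h]
  simp

/-- The images of the `l_k^{-1,β}`, `k ≥ 1`, under the energy map are complete in the
orthogonal complement of the range of `traceMap`. -/
lemma eq_zero_of_inner_energyMap_lag {β γ : ℝ} (hβ : 0 < β) (hγ : 0 < γ)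
    {x : WithLp 2 (L2 × L2)} (h1 : ∀ p, inner ℝ (traceMap hβ γ p) x = 0)
    (h2 : ∀ k, 1 ≤ k → inner ℝ (energyMap γ (lag (-1) hβ k)) x = 0) : x = 0 := by
  set s := √γ with hs
  have hs0 : 0 < s := Real.sqrt_pos.2 hγ
  set a : L2 := x.fst with ha
  set b : L2 := x.snd with hb
  have t1 : ∀ p, s * inner ℝ a (expL2 hβ p) + inner ℝ b (wderiv (expPoly hβ p)) = 0 := by
    intro p
    have h : inner ℝ (expL2 hβ p) a + inner ℝ (s⁻¹ • wderiv (expPoly hβ p)) b = 0 := h1 p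
    rw [real_inner_smul_left, real_inner_comm, real_inner_comm b] at h
    field_simp at h
    linarith
  have t2 : ∀ k, 1 ≤ k → inner ℝ a (wderiv (lag (-1) hβ k)) +
      s * inner ℝ b (val (lag (-1) hβ k)) = 0 := by
    intro k hk
    have h : inner ℝ (wderiv (lag (-1) hβ k)) a + inner ℝ (s • val (lag (-1) hβ k)) b = 0 :=
      h2 k hk
    rw [real_inner_smul_left, real_inner_comm, real_inner_comm b] at h
    exact h
  set w := fun k => inner ℝ (a + b) (expL2 hβ (lagSum β k)) with hw
  -- Adding the two orthogonality relations for l_k gives (s - β/2) w_{k+1} = (s + β/2) w_k.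
  -- Iterated upwards, it expresses w_k as q^n w_{k+n}, which tends to 0 because w is bounded.
  have rec1 : ∀ k, 1 ≤ k → |w k| = |(2 * s - β) / (2 * s + β)| * |w (k + 1)| := by
    intro k hk
    have e1 := t1 (scaledLaguerre (-1) β k)
    have e2 := t2 k hk
    rw [show expPoly hβ (scaledLaguerre (-1) β k) = lag (-1) hβ k from rfl,
      show expL2 hβ (scaledLaguerre (-1) β k) = val (lag (-1) hβ k) from rfl] at e1
    rw [val_lag, wderiv_lag, real_inner_smul_right, inner_add_right, inner_sub_right] at e1 e2
    have hP : 2 * s + β ≠ 0 := by positivity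
    rw [← abs_mul]
    congr 1
    simp only [hw, inner_add_left]
    field_simp
    linarith
  have hq : |(2 * s - β) / (2 * s + β)| < 1 := by
    rw [abs_div, abs_of_pos (sqrt_add_pos hβ), div_lt_one (sqrt_add_pos hβ)]
    exact abs_sqrt_sub_lt hβ hγ
  have bound : ∀ k, |w (k + 1)| ≤ ‖a + b‖ * √(1 / β) := by
    intro k
    refine (abs_real_inner_le_norm _ _).trans (mul_le_mul_of_nonneg_left ?_ (norm_nonneg _))
    refine Real.le_sqrt_of_sq_le ?_
    rw [← real_inner_self_eq_norm_sq, inner_lagSum, if_pos (by simp)]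
  have w0 : ∀ k, w (k + 1) = 0 := by
    intro k
    have it : ∀ n, |w (k + 1)| = |(2 * s - β) / (2 * s + β)| ^ n * |w (k + 1 + n)| := by
      intro n
      induction n with
      | zero => simp
      | succ n ih =>
        rw [ih, rec1 _ (by omega), pow_succ, ← add_assoc]
        ring
    have lim : Tendsto (fun n : ℕ => |(2 * s - β) / (2 * s + β)| ^ n * (‖a + b‖ * √(1 / β)))
        atTop (𝓝 0) := by
      simpa using (tendsto_pow_atTop_nhds_zero_of_lt_one (abs_nonneg _) hq).mul_const
        (‖a + b‖ * √(1 / β))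
    refine abs_eq_zero.1 (le_antisymm (ge_of_tendsto' lim fun n => ?_) (abs_nonneg _))
    rw [it n, add_right_comm]
    exact mul_le_mul_of_nonneg_left (bound _) (by positivity)
  have w1 : ∀ k, w k = 0 := fun k => by
    rcases k with _ | k
    · simp [hw, lagSum_zero]
    · exact w0 k
  have hab : a + b = 0 := by
    refine eq_zero_of_inner_expL2_eq_zero hβ fun p => ?_
    let M : Submodule ℝ ℝ[X] := LinearMap.ker ((innerₗ L2 (a + b)).comp (expL2 hβ))
    have hM : ∀ k, lagSum β k ∈ M := w1
    have e1 : p - C (p.eval 0) ∈ M := by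
      refine mem_of_forall_scaledLaguerre_mem hβ M p.natDegree (fun k _ _ => ?_) _ ?_ (by simp)
      · have := M.sub_mem (hM (k + 1)) (hM k)
        rwa [lagSum_succ, add_sub_cancel_left] at this
      · exact (natDegree_sub_C).le
    have e2 : C (p.eval 0) ∈ M := by
      have := M.smul_mem (p.eval 0) (hM 1)
      rwa [lagSum_one, smul_eq_C_mul, mul_one] at this
    have := M.add_mem e1 e2
    rw [sub_add_cancel] at this
    exact this
  have hba : b = -a := eq_neg_of_add_eq_zero_right hab
  have a0 : a = 0 := by
    refine eq_zero_of_inner_expL2_eq_zero hβ fun p => ?_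
    -- With b = -a the trace relation alone trades p for its derivative, with a nonzero factor on
    -- the left; repeated differentiation kills every polynomial.
    have step : ∀ p, (s + β / 2) * inner ℝ a (expL2 hβ p) =
        inner ℝ a (expL2 hβ (derivative p)) := fun p => by
      have := t1 p
      rw [hba, inner_neg_left, wderiv_expPoly, map_sub, expL2_C_mul, inner_sub_right,
        real_inner_smul_right] at this
      linarith
    have hc : s + β / 2 ≠ 0 := by positivity
    have : ∀ n, ∀ p : ℝ[X], p.natDegree ≤ n → inner ℝ a (expL2 hβ p) = 0 := by
      intro n
      induction n with
      | zero =>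
        intro p hp
        have := step p
        rw [derivative_of_natDegree_zero (Nat.le_zero.1 hp), map_zero, inner_zero_right] at this
        exact (mul_eq_zero.1 this).resolve_left hc
      | succ n ih =>
        intro p hp
        have := step p
        rw [ih _ ((natDegree_derivative_le p).trans (by omega))] at this
        exact (mul_eq_zero.1 this).resolve_left hc
    exact this _ p le_rfl
  refine (WithLp.ofLp_injective 2) (Prod.ext ?_ ?_)
  · exact a0
  · exact hba.trans (by rw [a0, neg_zero]; rfl)

/-- The vectors orthogonal to the range of `traceMap`. -/
def energySpace {β : ℝ} (hβ : 0 < β) (γ : ℝ) : Submodule ℝ (WithLp 2 (L2 × L2)) :=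
  (LinearMap.range (traceMap hβ γ))ᗮ

instance {β : ℝ} (hβ : 0 < β) (γ : ℝ) : CompleteSpace (energySpace hβ γ) :=
  inferInstanceAs (CompleteSpace (LinearMap.range (traceMap hβ γ))ᗮ)

lemma energyMap_mem_energySpace {β γ : ℝ} (hβ : 0 < β) (hγ : 0 < γ) (v : H01) :
    energyMap γ v ∈ energySpace hβ γ := by
  rw [energySpace, Submodule.mem_orthogonal]
  rintro _ ⟨p, rfl⟩
  exact inner_traceMap_energyMap hβ hγ v.2 p

/-- The normalized images of the functions `S_k^β`. -/
def energyBasisFun {β γ : ℝ} (hβ : 0 < β) (hγ : 0 < γ) (k : ℕ) : energySpace hβ γ :=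
  ⟨(√(rho β γ (k + 1)))⁻¹ • energyMap γ (sob hβ γ (k + 1)),
    Submodule.smul_mem _ _ (energyMap_mem_energySpace hβ hγ _)⟩

lemma orthonormal_energyBasisFun {β γ : ℝ} (hβ : 0 < β) (hγ : 0 < γ) :
    Orthonormal ℝ (energyBasisFun hβ hγ) := by
  rw [orthonormal_iff_ite]
  intro i j
  change inner ℝ ((√(rho β γ (i + 1)))⁻¹ • energyMap γ (sob hβ γ (i + 1)))
    ((√(rho β γ (j + 1)))⁻¹ • energyMap γ (sob hβ γ (j + 1))) = _
  rw [real_inner_smul_left, real_inner_smul_right, inner_energyMap hγ,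
    dirichletForm_sob hβ hγ (by omega) (by omega)]
  rcases eq_or_ne i j with rfl | h
  · have hr := rho_pos hβ hγ (by omega : 1 ≤ i + 1)
    have hs := (Real.sqrt_pos.2 hr).ne'
    rw [if_pos rfl, if_pos rfl, ← mul_assoc, ← mul_inv, Real.mul_self_sqrt hr.le,
      inv_mul_cancel₀ hr.ne']
  · rw [if_neg (by omega), if_neg h]
    simp

lemma scaledLaguerre_mem_of_sobPoly_mem {β γ : ℝ} {M : Submodule ℝ ℝ[X]}
    (h : ∀ k, sobPoly β γ (k + 1) ∈ M) (k : ℕ) : scaledLaguerre (-1) β (k + 1) ∈ M := by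
  rcases k with _ | k
  · exact h 0
  · have := M.add_mem (h (k + 1)) (M.smul_mem (dOf β γ (rho β γ (k + 1))) (h k))
    rwa [sobPoly, smul_eq_C_mul, sub_add_cancel] at this

/-- Being orthogonal to all S_k is being orthogonal to all l_k with k ≥ 1, and membership in
`energySpace` supplies the trace relations. -/
lemma orthogonal_span_energyBasisFun {β γ : ℝ} (hβ : 0 < β) (hγ : 0 < γ) :
    (Submodule.span ℝ (range (energyBasisFun hβ hγ)))ᗮ = ⊥ := by
  rw [Submodule.eq_bot_iff]
  intro x hx
  rw [Submodule.mem_orthogonal] at hx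
  refine Subtype.ext (eq_zero_of_inner_energyMap_lag hβ hγ (fun p => ?_) fun k hk => ?_)
  · exact (Submodule.mem_orthogonal _ _).1 x.2 _ ⟨p, rfl⟩
  · let M : Submodule ℝ ℝ[X] := LinearMap.ker
      ((innerₗ (WithLp 2 (L2 × L2)) (x : WithLp 2 (L2 × L2))).comp
        ((energyMap γ).comp (expH1 hβ)))
    have hM : ∀ k, sobPoly β γ (k + 1) ∈ M := fun k => by
      have h : inner ℝ ((√(rho β γ (k + 1)))⁻¹ • energyMap γ (sob hβ γ (k + 1)))
        (x : WithLp 2 (L2 × L2)) = 0 := hx _ (Submodule.subset_span ⟨k, rfl⟩)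
      have hs := (Real.sqrt_pos.2 (rho_pos hβ hγ (by omega : 1 ≤ k + 1))).ne'
      rw [real_inner_smul_left, real_inner_comm] at h
      exact (mul_eq_zero.1 h).resolve_left (inv_ne_zero hs)
    obtain ⟨k, rfl⟩ : ∃ l, k = l + 1 := ⟨k - 1, by omega⟩
    rw [real_inner_comm]
    exact scaledLaguerre_mem_of_sobPoly_mem hM k

/-- Recovers `(v, v')` from `(v', √γ v)`. -/
def energyInv (γ : ℝ) : WithLp 2 (L2 × L2) →L[ℝ] WithLp 2 (L2 × L2) :=
  ((WithLp.prodContinuousLinearEquiv 2 ℝ L2 L2).symm : (L2 × L2) →L[ℝ] WithLp 2 (L2 × L2)).comp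
    (((√γ)⁻¹ • WithLp.sndL 2 ℝ L2 L2).prod (WithLp.fstL 2 ℝ L2 L2))

lemma energyInv_energyMap {γ : ℝ} (hγ : 0 < γ) (v : H1) : energyInv γ (energyMap γ v) = v := by
  have hs := (Real.sqrt_pos.2 hγ).ne'
  refine (WithLp.ofLp_injective 2) (Prod.ext ?_ rfl)
  change (√γ)⁻¹ • √γ • val v = val v
  rw [smul_smul, inv_mul_cancel₀ hs, one_smul]

/-- The Sobolev orthogonal expansion of the elements of `H¹₀(Λ)`. -/
lemma hasSum_sob {β γ : ℝ} (hβ : 0 < β) (hγ : 0 < γ) (v : H01) :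
    HasSum (fun k : ℕ => (dirichletForm γ v (sob hβ γ (k + 1)) / rho β γ (k + 1)) •
      (sob hβ γ (k + 1) : H1)) (v : H1) := by
  let b := HilbertBasis.mkOfOrthogonalEqBot (orthonormal_energyBasisFun hβ hγ)
    (orthogonal_span_energyBasisFun hβ hγ)
  have h1 := b.hasSum_repr ⟨energyMap γ v, energyMap_mem_energySpace hβ hγ v⟩
  have h2 := (energyInv γ).hasSum ((energySpace hβ γ).subtypeL.hasSum h1)
  -- The Hilbert basis expansion lives in L² × L². Since H¹ carries the induced topology, it
  -- suffices to sum there, after undoing the energy map by a continuous linear map.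
  rw [← Topology.IsInducing.subtypeVal.hasSum_iff (g := H1.subtype)]
  have e : H1.subtype v = energyInv γ ((energySpace hβ γ).subtypeL
      ⟨energyMap γ v, energyMap_mem_energySpace hβ hγ v⟩) := (energyInv_energyMap hγ v).symm
  rw [e]
  convert! h2 using 1
  funext k
  have hr := rho_pos hβ hγ (by omega : 1 ≤ k + 1)
  have hb : b k = energyBasisFun hβ hγ k := by
    rw [HilbertBasis.coe_mkOfOrthogonalEqBot]
  have hi : b.repr ⟨energyMap γ v, energyMap_mem_energySpace hβ hγ v⟩ k =
      (√(rho β γ (k + 1)))⁻¹ * dirichletForm γ v (sob hβ γ (k + 1)) := by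
    rw [HilbertBasis.repr_apply_apply, hb, dirichletForm_comm, ← inner_energyMap hγ,
      ← real_inner_smul_left]
    rfl
  rw [hi, hb, map_smul, map_smul]
  change _ = _ • energyInv γ ((√(rho β γ (k + 1)))⁻¹ • energyMap γ (sob hβ γ (k + 1)))
  rw [map_smul, energyInv_energyMap hγ, smul_smul, mul_right_comm, ← mul_inv,
    Real.mul_self_sqrt hr.le, ← div_eq_inv_mul]
  rfl

end Completeness

/-! ### Expansion of the exact and the discrete solution. -/

/-- Orthogonality to each S_k passes to every v in H¹₀ through the expansion of v, by continuity of
the form. -/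
lemma dirichletForm_S0 {β γ : ℝ} (hβ : 0 < β) (hγ : 0 < γ) (v : H01) :
    dirichletForm γ (S0 hβ γ) v = 0 := by
  have h := (hasSum_sob hβ hγ v).map (dirichletBilin γ (S0 hβ γ))
    (continuous_dirichletForm_right γ (S0 hβ γ))
  refine h.unique ?_
  convert! (hasSum_zero : HasSum (fun _ : ℕ => (0 : ℝ)) 0) using 2 with k
  simp only [Function.comp_apply, map_smul, dirichletBilin_apply, dirichletForm_S0_sob hβ hγ,
    smul_zero]

lemma dirichletForm_sub_smul (γ : ℝ) (u w v : H1) (c : ℝ) :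
    dirichletForm γ (u - c • w) v = dirichletForm γ u v - c * dirichletForm γ w v := by
  simp only [← dirichletBilin_apply, map_sub, map_smul, LinearMap.sub_apply, LinearMap.smul_apply,
    smul_eq_mul]

lemma IsWeakSolution.hasSum {β γ : ℝ} (hβ : 0 < β) (hγ : 0 < γ) {η : ℝ} {f : H01 →L[ℝ] ℝ} {u : H1}
    (hu : IsWeakSolution γ f η u) :
    HasSum (fun k : ℕ => uHat hβ γ f (k + 1) • (sob hβ γ (k + 1) : H1)) (u - η • S0 hβ γ) := by
  have ht : HasTrace (u - η • S0 hβ γ) 0 := by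
    obtain ⟨U, hU, hU0⟩ := hu.1
    obtain ⟨V, hV, hV0⟩ := hasTrace_S0 hβ hγ
    exact ⟨_, hU.sub_smul hV η, by simp [hU0, hV0]⟩
  convert! hasSum_sob hβ hγ ⟨u - η • S0 hβ γ, ht⟩ using 3 with k
  rw [uHat, ← hu.2, dirichletForm_sub_smul, dirichletForm_S0 hβ hγ, mul_zero, sub_zero]

lemma IsWeakSolution.hasSum_apply {β γ : ℝ} (hβ : 0 < β) (hγ : 0 < γ) {η : ℝ} {f : H01 →L[ℝ] ℝ}
    {u : H1} (hu : IsWeakSolution γ f η u) {U : ℝ → ℝ} (hU : IsContRep u U) {x : ℝ} (hx : 0 ≤ x) :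
    HasSum (fun k : ℕ => uHat hβ γ f (k + 1) * sobFun β γ (k + 1) x)
      (U x - η * S0Fun β γ x) := by
  obtain ⟨K, hK⟩ := exists_evaluation
  obtain ⟨T, hT, -⟩ := hK x hx
  have h := T.hasSum (hu.hasSum hβ hγ)
  simp only [map_smul, smul_eq_mul] at h
  rw [← hT _ _ (hU.sub_smul (isContRep_S0 hβ hγ) η)] at h
  convert! h using 3 with k
  exact hT _ _ (isContRep_expPoly hβ _)

lemma IsDiscreteSolution.eq_sum {β γ : ℝ} (hβ : 0 < β) (hγ : 0 < γ) {η : ℝ} {f : H01 →L[ℝ] ℝ}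
    {N : ℕ} {uN : H1} (h : IsDiscreteSolution hβ γ f η N uN) :
    uN = η • S0N hβ γ N + ∑ k ∈ Finset.Icc 1 N, uHat hβ γ f k • (sob hβ γ k : H1) := by
  obtain ⟨⟨p, hp, rfl⟩, ht, hf⟩ := h
  obtain ⟨q, hq, hS⟩ := S0N_mem_XN hβ γ N
  have hp0 : p.eval 0 = η := (hasTrace_expPoly hβ p).unique ht
  have hq0 : q.eval 0 = 1 :=
    (hasTrace_expPoly hβ q).unique (hS ▸ hasTrace_S0N hβ hγ N)
  have h1 : expPoly hβ p - η • S0N hβ γ N ∈ XN0 hβ N := by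
    refine ⟨p - η • q, (natDegree_sub_le_of_le hp
      ((natDegree_smul_le η q).trans hq)).trans_eq (max_self N), by simp [hp0, hq0], ?_⟩
    rw [hS]
    rw [← expH1_apply, ← expH1_apply, ← expH1_apply, map_sub, map_smul]
  have h2 : ∑ k ∈ Finset.Icc 1 N, uHat hβ γ f k • (sob hβ γ k : H1) ∈ XN0 hβ N := by
    have e : ∑ k ∈ Finset.Icc 1 N, uHat hβ γ f k • (sob hβ γ k : H1) =
        expPoly hβ (∑ k ∈ Finset.Icc 1 N, uHat hβ γ f k • sobPoly β γ k) := by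
      rw [← expH1_apply, map_sum]
      simp only [map_smul]
      rfl
    rw [e]
    refine expPoly_mem_XN0 hβ (natDegree_sum_le_of_forall_le _ _ fun k hk => ?_) ?_
    · exact (natDegree_smul_le _ _).trans
        ((natDegree_sobPoly_le γ k).trans (Finset.mem_Icc.1 hk).2)
    · simp [eval_finsetSum, sobPoly_eval_zero]
  -- Both u_N - η S_{0,N} and the finite sum lie in X_N^{0,β} and have the same product f(S_j) with
  -- each S_j, j ≤ N, so their difference vanishes.
  have key := eq_zero_of_forall_sob hβ hγ (sub_mem_XN0 hβ h1 h2) fun j hj1 hj2 => ?_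
  · rw [← sub_eq_zero, ← sub_sub]
    exact key
  · have hr := (rho_pos hβ hγ hj1).ne'
    have hsum : dirichletForm γ (∑ k ∈ Finset.Icc 1 N, uHat hβ γ f k • (sob hβ γ k : H1))
        (sob hβ γ j) = f (sob hβ γ j) := by
      rw [← dirichletBilin_apply, map_sum, LinearMap.sum_apply, Finset.sum_eq_single j]
      · rw [map_smul, LinearMap.smul_apply, dirichletBilin_apply, dirichletForm_sob hβ hγ hj1 hj1,
          if_pos rfl, uHat, smul_eq_mul, div_mul_cancel₀ _ hr]
      · intro k hk hkj
        rw [map_smul, LinearMap.smul_apply, dirichletBilin_apply,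
          dirichletForm_sob hβ hγ (Finset.mem_Icc.1 hk).1 hj1, if_neg hkj, smul_zero]
      · exact fun hn => absurd (Finset.mem_Icc.2 ⟨hj1, hj2⟩) hn
    have hmem := XN0_mono hβ hj2 (sob_mem_XN0 hβ γ j)
    rw [← dirichletBilin_apply, map_sub, LinearMap.sub_apply, dirichletBilin_apply,
      dirichletBilin_apply, hsum, dirichletForm_sub_smul, dirichletForm_S0N hβ hγ N hmem,
      hf _ hmem, mul_zero, sub_zero, sub_self]

end

end LaguerreDirichlet

theorem theorem3p2 {β γ : ℝ} (hβ : 0 < β) (hγ : 0 < γ) (η : ℝ) (f : H01 →L[ℝ] ℝ) (N : ℕ) :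
    -- the functions `S_k^β`, `k ≥ 1`, are exactly the Sobolev orthogonal Laguerre functions
    (∀ (S : ℕ → H01) (r : ℕ → ℝ),
      IsSobolevOrthogonal hβ γ S r ↔ ∀ k ≥ 1, S k = sob hβ γ k ∧ r k = rho β γ k) ∧
    (∀ k ≥ 1, 0 < rho β γ k) ∧
    -- `S_0^β`: its series converges in `H¹(Λ)` and pointwise to the same function,
    -- its value at 0 is 1, and it is orthogonal to `H¹₀(Λ)`
    HasSum (fun m : ℕ => coeff0 β γ m • lag (-1) hβ m) (S0 hβ γ) ∧
    (∀ x ≥ 0, HasSum (fun m : ℕ => coeff0 β γ m * lagFun (-1) β m x) (S0Fun β γ x)) ∧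
    IsContRep (S0 hβ γ) (S0Fun β γ) ∧
    HasTrace (S0 hβ γ) 1 ∧
    (∀ v : H01, dirichletForm γ (S0 hβ γ) v = 0) ∧
    -- `S_{0,N}^β` is in `X_N^β`, its value at 0 is 1, and it is orthogonal to `X_N^{0,β}`
    S0N hβ γ N ∈ XN hβ N ∧
    HasTrace (S0N hβ γ N) 1 ∧
    (∀ v ∈ XN0 hβ N, dirichletForm γ (S0N hβ γ N) v = 0) ∧
    -- the exact solution: `û_k = A_γ(u, S_k^β) / ϱ_k = (f, S_k^β) / ϱ_k` for `k ≥ 1`, and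
    -- `u = η S_0^β + ∑_{k ≥ 1} û_k S_k^β` in `H¹(Λ)` and at every point
    (∀ u : H1, IsWeakSolution γ f η u →
      (∀ k ≥ 1, dirichletForm γ u (sob hβ γ k) / rho β γ k = uHat hβ γ f k) ∧
      HasSum (fun k : ℕ => uHat hβ γ f (k + 1) • (sob hβ γ (k + 1) : H1)) (u - η • S0 hβ γ) ∧
      (∀ U : ℝ → ℝ, IsContRep u U → ∀ x ≥ 0,
        HasSum (fun k : ℕ => uHat hβ γ f (k + 1) * sobFun β γ (k + 1) x)
          (U x - η * S0Fun β γ x))) ∧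
    -- the discrete solution: `u_N = η S_{0,N}^β + ∑_{k = 1}^N û_k S_k^β`
    (∀ uN : H1, IsDiscreteSolution hβ γ f η N uN →
      uN = η • S0N hβ γ N + ∑ k ∈ Finset.Icc 1 N, uHat hβ γ f k • (sob hβ γ k : H1)) := by
  refine ⟨isSobolevOrthogonal_iff hβ hγ, fun k hk => rho_pos hβ hγ hk, hasSum_S0 hβ hγ,
    fun x hx => hasSum_S0Fun hβ hγ hx, isContRep_S0 hβ hγ, hasTrace_S0 hβ hγ,
    dirichletForm_S0 hβ hγ, S0N_mem_XN hβ γ N, hasTrace_S0N hβ hγ N,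
    fun v hv => dirichletForm_S0N hβ hγ N hv, fun u hu => ⟨fun k _ => ?_, hu.hasSum hβ hγ,
      fun U hU x hx => hu.hasSum_apply hβ hγ hU hx⟩, fun uN h => h.eq_sum hβ hγ⟩
  rw [hu.2, uHat]
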